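/- **Setting.** Let $c>0$, let $\mathcal M=\mathbb R^4$ be Minkowski space with coordinates $(x^0=ct,x^1,x^2,x^3)$ and $\eta=\mathrm{diag}(-1,1,1,1)$. Let $E\to\mathcal M$ be a natural vector bundle of finite rank (trivialised once and for all as $\mathcal M\times F$, which is used only to speak of derivatives of sections): every diffeomorphism $\varphi$ of $\mathcal M$ has a smooth, functorial lift $\hat\varphi_p:E_p\to E_{\varphi(p)}$ by linear isomorphisms which depends only on the germ of $\varphi$ at $p$, and for the flow $\varphi_t$ of any complete vector field and any smooth section $\Psi$ the pushforward $(\varphi_t)_*\Psi=\hat\varphi_t\circ\Psi\circ\varphi_t^{-1}$ is smooth in $t$ and the point. Call an open $V\subseteq\mathcal M$ *admissible* for $\Psi$ if $\operatorname{supp}\Psi\cap\overline V$ is compact. Let $S[g,\Psi;V]\in\mathbb R$ be an action, defined for Lorentzian metrics $g$, smooth sections $\Psi$ and admissible $V$, which is diffeomorphism invariant, $$S[\varphi_*g,\varphi_*\Psi;\varphi(V)]=S[g,\Psi;V],$$ and has a Hilbert energy-momentum tensor: a symmetric tensor field $T^{\mu\nu}[g,\Psi]$, depending smoothly on $(g,\Psi)$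 (smooth families of fields give smooth families of tensor fields), with $\operatorname{supp}T[g,\Psi]\subseteq\operatorname{supp}\Psi$ and $$S[g_\varepsilon,\Psi;V]=S[g_0,\Psi;V]+\frac1{2c}\int_V d^4x\,\sqrt{|\det g_0|}\;T^{\mu\nu}[g_0,\Psi]\,(g_\varepsilon-g_0)_{\mu\nu}+O(\varepsilon^2)$$ for all smooth families of Lorentzian metrics $g_\varepsilon$ and all admissible $V$. Let $\Psi$ be a smooth section. It is *spatially compact* if $\operatorname{supp}\Psi\subseteq\mathbb R\times K$ with $K\subset\mathbb R^3$ compact. **1. The anomalous coupling depends on the representative.** Let $\Psi$ be spatially compact, $V=(s_0,s_1)\times\mathbb R^3$, $\bar x\in\mathbb R^3$, and for a constant $\Phi$ let $h_{\mu\nu}=-2\frac{\Phi}{c^2}\delta_{\mu\nu}$. There is $\xi\in C_c^\infty(\mathbb R^3)$ with $\xi=1$ on the spatial projection of $\operatorname{supp}\Psi$ such that the field $X^0=0$, $X^a=-\xi(\vec x)(x^a-\bar x^a)$ has a complete flow preserving each slice $x^0=\text{const}$, and such that, with $\varphi$ the flow diffeomorphism for parameter $\Phi/c^2$ and $h'=\varphi_*(\eta+h)-\eta$,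 as $\Phi\to0$: * $h'_{\mu\nu}=-2\frac{\Phi}{c^2}\delta^0_\mu\delta^0_\nu+O(\Phi^2)$ uniformly on $\operatorname{supp}(\varphi_*\Psi)$; * $S[\eta+h,\Psi;V]=S[\eta+h',\varphi_*\Psi;V]$ for all sufficiently small $\Phi$; * $S[\eta+h,\Psi;V]=S[\eta,\Psi;V]-\frac1c\int_V d^4x\,\frac{\Phi}{c^2}\bigl(T^{00}+\sum_{a=1}^3T^{aa}\bigr)[\eta,\Psi]+O(\Phi^2)$; * $S[\eta+h,\Psi;V]=S[\eta,\varphi_*\Psi;V]-\frac1c\int_V d^4x\,\frac{\Phi}{c^2}\,T^{00}[\eta,\varphi_*\Psi]+O(\Phi^2)$. **2. Energy-momentum conservation.** Suppose $\Psi$ solves the field equations on Minkowski space: for every admissible $V$, $\frac{d}{d\varepsilon}\big|_{0}S[\eta,\Psi_\varepsilon;V]=0$ for every smooth family $\Psi_\varepsilon$ with $\Psi_0=\Psi$ that agrees with $\Psi$ outside a fixed compact subset of $V$. Then, for every admissible $V$ and every vector field $X$ vanishing outside a compact subset of $V$, with flow $\varphi_\varepsilon$, $$S[\eta,\varphi_{\varepsilon*}\Psi;V]=S[\eta,\Psi;V]+O(\varepsilon^2),\qquad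 \int_V d^4x\,T^{\mu\nu}[\eta,\Psi]\,(h_\varepsilon-h'_\varepsilon)_{\mu\nu}=O(\varepsilon^2)$$ for every smooth family $h_\varepsilon$ with $h_0=0$ and $\eta+h_\varepsilon$ Lorentzian for small $\varepsilon$, where $h'_\varepsilon=\varphi_{\varepsilon*}(\eta+h_\varepsilon)-\eta$. Moreover $T^{\mu\nu}[\eta,\Psi]$ is differentiable and $\partial_\mu T^{\mu\nu}[\eta,\Psi]=0$. **3. Virial theorem.** Suppose in addition that * $\Psi$ is spatially compact and its motion is bounded: for each $k$, the $k$-th derivatives of the time translates $(\tau_{-s})_*\Psi$, $s\ge0$, where $\tau_s(x^0,\vec x)=(x^0+s,\vec x)$, are bounded on the slice $x^0=0$ uniformly in $s$; * the temporal boundary term is local in the fields: for every $\xi\in C_c^\infty(\mathbb R^3)$ and $\bar x\in\mathbb R^3$, and for the flow $\varphi_\varepsilon$ of $X^0=0$, $X^a=-\xi(\vec x)(x^a-\bar x^a)$, there are $k$ and continuous densities $b_0,b_1$, functions of $\vec x$ and of the $k$-jet of the field that vanish at zero jet, such that for all spatially compact solutions $\Psi'$ and all $t>0$ $$\frac{d}{d\varepsilon}\Big|_{0}S[\eta,\varphi_{\varepsilon*}\Psi';(0,ct)\times\mathbb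 R^3]=\int_{\mathbb R^3}b_1\bigl(\vec x,j^k((\tau_{-ct})_*\Psi')(0,\vec x)\bigr)d^3x+\int_{\mathbb R^3}b_0\bigl(\vec x,j^k\Psi'(0,\vec x)\bigr)d^3x .$$ Then $\sum_aT^{aa}[\eta,\Psi]$ is integrable on $[0,ct]\times\mathbb R^3$ for every $t$, and $$\lim_{t\to\infty}\frac1t\int_{[0,ct]\times\mathbb R^3}d^4x\,\sum_{a=1}^3T^{aa}[\eta,\Psi]=0 .$$ -/

import Mathlib

open Set Filter Topology MeasureTheory Asymptotics
open scoped ContDiff Manifold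

noncomputable section

namespace WeakGravity

/-- Spacetime `ℝ⁴` in global coordinates `(x⁰ = ct, x¹, x², x³)`.  The norm plays no role: it only
gives the usual topology and differentiable structure. -/
abbrev Spacetime : Type := Fin 4 → ℝ

/-- Space `ℝ³`. -/
abbrev Space : Type := Fin 3 → ℝ

/-- The spatial coordinates of an event. -/
def spatial (x : Spacetime) : Space := fun a => x a.succ

/-- The event at `x⁰ = s` with spatial coordinates `y`. -/
def event (s : ℝ) (y : Space) : Spacetime := Fin.cons s y

/-- Second-rank tensor fields, by their components in the global coordinates. -/
abbrev TensorField : Type := Spacetime → Matrix (Fin 4) (Fin 4) ℝ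

/-- `diag(-1, 1, 1, 1)`. -/
def etaMatrix : Matrix (Fin 4) (Fin 4) ℝ := Matrix.diagonal (Fin.cons (-1) fun _ => 1)

/-- The Minkowski metric `η`. -/
def eta : TensorField := fun _ => etaMatrix

/-- `∑ μ ν, A^{μν} B_{μν}`. -/
def contract (A B : Matrix (Fin 4) (Fin 4) ℝ) : ℝ := ∑ μ, ∑ ν, A μ ν * B μ ν

/-- A smooth one-parameter family of tensor fields, jointly smooth in parameter and point. -/
def SmoothTensorFamily (γ : ℝ → TensorField) : Prop :=
  ∀ μ ν, ContDiff ℝ ∞ fun p : ℝ × Spacetime => γ p.1 p.2 μ ν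

/-- Smooth Lorentzian metrics of signature `(-,+,+,+)`; by the congruence condition
(Sylvester's law of inertia) such a matrix field is symmetric. -/
structure IsLorentzian (g : TensorField) : Prop where
  smooth : ∀ μ ν, ContDiff ℝ ∞ fun x => g x μ ν
  signature : ∀ x, ∃ P : Matrix (Fin 4) (Fin 4) ℝ,
    IsUnit P.det ∧ P.transpose * g x * P = etaMatrix

/-- Diffeomorphisms of spacetime. -/
abbrev Diffeo : Type := Diffeomorph 𝓘(ℝ, Spacetime) 𝓘(ℝ, Spacetime) Spacetime Spacetime ∞

/-- The Jacobian matrix `∂f^μ/∂x^ν`. -/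
def jacobian (f : Spacetime → Spacetime) (x : Spacetime) : Matrix (Fin 4) (Fin 4) ℝ :=
  fun μ ν => fderiv ℝ f x (Pi.single ν 1) μ

/-- The pushforward `φ_* g = (φ⁻¹)^* g` of a covariant two-tensor field:
`(φ_* g)_{μν}(x) = ∂_μ(φ⁻¹)^α ∂_ν(φ⁻¹)^β g_{αβ}(φ⁻¹ x)`. -/
def pushTensor (φ : Diffeo) (g : TensorField) : TensorField := fun x =>
  (jacobian φ.symm x).transpose * g (φ.symm x) * jacobian φ.symm x

/-- `φ` is the (complete) flow of the vector field `X`. -/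
structure IsFlow (X : Spacetime → Spacetime) (φ : ℝ → Diffeo) : Prop where
  smooth : ContDiff ℝ ∞ fun p : ℝ × Spacetime => φ p.1 p.2
  zero : ∀ x, φ 0 x = x
  deriv : ∀ t x, HasDerivAt (fun s => φ s x) (X (φ t x)) t

section Matter

variable {F : Type*} [NormedAddCommGroup F] [NormedSpace ℝ F]

/-- The pushforward `φ̂ ∘ Ψ ∘ φ⁻¹` of a section along a family `φ̂_p = lift φ p : E_p → E_{φ p}` of
linear isomorphisms. -/
def pushAlong (lift : Diffeo → Spacetime → F ≃L[ℝ] F) (φ : Diffeo) (Ψ : Spacetime → F) :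
    Spacetime → F := fun x => lift φ (φ.symm x) (Ψ (φ.symm x))

/-- A smooth one-parameter family of matter fields. -/
def SmoothFieldFamily (ψ : ℝ → Spacetime → F) : Prop :=
  ContDiff ℝ ∞ fun p : ℝ × Spacetime => ψ p.1 p.2

variable (F) in
/-- A natural vector bundle over spacetime with typical fibre `F`.  Every smooth vector bundle
over `ℝ⁴` is trivial, so the total space is taken to be `ℝ⁴ × F`, and sections are smooth maps to
`F`; the content is the functorial lift `φ̂_p : E_p → E_{φ p}` of diffeomorphisms, which need not be
trivial in any way.  The lift at `p` depends on the germ of `φ` at `p` only, and pushforward along a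
flow is smooth in the flow parameter. -/
structure NaturalBundle where
  lift : Diffeo → Spacetime → F ≃L[ℝ] F
  smooth_lift : ∀ φ, ContDiff ℝ ∞ fun p => (lift φ p : F →L[ℝ] F)
  lift_id : ∀ p, lift (Diffeomorph.refl _ _ _) p = ContinuousLinearEquiv.refl ℝ F
  lift_comp : ∀ (φ₁ φ₂ : Diffeo) (p : Spacetime),
    lift (φ₂.trans φ₁) p = (lift φ₂ p).trans (lift φ₁ (φ₂ p))
  lift_local : ∀ (φ₁ φ₂ : Diffeo) (p : Spacetime),
    (∀ᶠ q in 𝓝 p, φ₁ q = φ₂ q) → lift φ₁ p = lift φ₂ p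
  smooth_flow : ∀ (X : Spacetime → Spacetime) (φ : ℝ → Diffeo), IsFlow X φ →
    ∀ Ψ : Spacetime → F, ContDiff ℝ ∞ Ψ →
      SmoothFieldFamily fun t => pushAlong lift (φ t) Ψ

/-- The pushforward `φ_* Ψ` of a section of a natural bundle. -/
def NaturalBundle.push (E : NaturalBundle F) (φ : Diffeo) (Ψ : Spacetime → F) : Spacetime → F :=
  pushAlong E.lift φ Ψ

/-- `S[g, Ψ; V]`.  Only its values at Lorentzian `g`, smooth `Ψ` and open `V` matter. -/
abbrev Action (F : Type*) : Type _ := TensorField → (Spacetime → F) → Set Spacetime → ℝ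

/-- The region of integration `V` is admissible for `Ψ` if it is open and meets the support of `Ψ`
in a relatively compact set (this is what makes actions finite). -/
def Admissible (Ψ : Spacetime → F) (V : Set Spacetime) : Prop :=
  IsOpen V ∧ IsCompact (tsupport Ψ ∩ closure V)

/-- `S[φ_* g, φ_* Ψ; φ(V)] = S[g, Ψ; V]`. -/
def DiffeoInvariant (E : NaturalBundle F) (S : Action F) : Prop :=
  ∀ (φ : Diffeo) (g : TensorField) (Ψ : Spacetime → F) (V : Set Spacetime),
    IsLorentzian g → ContDiff ℝ ∞ Ψ → Admissible Ψ V →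
      S (pushTensor φ g) (E.push φ Ψ) (φ '' V) = S g Ψ V

/-- `T` is the Hilbert energy-momentum tensor of the action `S`: the symmetric tensor field with
`S[g + g̃, Ψ; V] = S[g, Ψ; V] + 1/(2c) ∫_V √|det g| T^{μν}[g, Ψ] g̃_{μν} + O(g̃²)`,
the expansion being understood along smooth families of metrics.  It depends smoothly on the fields,
and locally on the matter field. -/
structure IsEnergyMomentumTensor (c : ℝ) (S : Action F)
    (T : TensorField → (Spacetime → F) → TensorField) : Prop where
  symm : ∀ g Ψ, IsLorentzian g → ContDiff ℝ ∞ Ψ → ∀ x, (T g Ψ x).IsSymm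
  smooth : ∀ (γ : ℝ → TensorField) (ψ : ℝ → Spacetime → F),
    SmoothTensorFamily γ → (∀ ε, IsLorentzian (γ ε)) → SmoothFieldFamily ψ →
      SmoothTensorFamily fun ε => T (γ ε) (ψ ε)
  locality : ∀ g Ψ, IsLorentzian g → ContDiff ℝ ∞ Ψ → tsupport (T g Ψ) ⊆ tsupport Ψ
  expansion : ∀ (γ : ℝ → TensorField) (Ψ : Spacetime → F) (V : Set Spacetime),
    SmoothTensorFamily γ → (∀ᶠ ε in 𝓝 (0 : ℝ), IsLorentzian (γ ε)) →
    ContDiff ℝ ∞ Ψ → Admissible Ψ V →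
      (fun ε : ℝ => S (γ ε) Ψ V - S (γ 0) Ψ V
        - 1 / (2 * c) * ∫ x in V,
            Real.sqrt |(γ 0 x).det| * contract (T (γ 0) Ψ x) (γ ε x - γ 0 x))
        =O[𝓝 0] fun ε : ℝ => ε ^ 2

/-- `Ψ` solves the field equations on Minkowski space: `δS/δΨ[η, Ψ; V] = 0` under variations
supported in compact subsets of `V`. -/
def SolvesFieldEquations (S : Action F) (Ψ : Spacetime → F) : Prop :=
  ∀ V : Set Spacetime, Admissible Ψ V →
    ∀ ψ : ℝ → Spacetime → F, SmoothFieldFamily ψ → ψ 0 = Ψ →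
      (∃ K : Set Spacetime, IsCompact K ∧ K ⊆ V ∧ ∀ ε, ∀ x ∉ K, ψ ε x = Ψ x) →
        HasDerivAt (fun ε => S eta (ψ ε) V) 0 0

/-- The support of `Ψ` is contained in `ℝ × K` with `K` compact. -/
def SpatiallyCompact (Ψ : Spacetime → F) : Prop :=
  ∃ K : Set Space, IsCompact K ∧ ∀ x ∈ tsupport Ψ, spatial x ∈ K

end Matter

/-- The open slab `{s₀ < x⁰ < s₁}`. -/
def slab (s₀ s₁ : ℝ) : Set Spacetime := {x | s₀ < x 0 ∧ x 0 < s₁}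

/-- The weak-field metric `η + h` with `h_{μν} = -2 (Φ/c²) δ_{μν}`, `Φ` constant. -/
def newtonianMetric (c Φ : ℝ) : TensorField := fun x => eta x + (-2 * (Φ / c ^ 2)) • 1

/-- The matrix `δ_μ^0 δ_ν^0`. -/
def timeTime : Matrix (Fin 4) (Fin 4) ℝ := Matrix.single 0 0 1

/-- The spatial rescaling field with cut-off `ξ` and centre `y`:
`X⁰ = 0`, `X^a(x) = -ξ(x) (x^a - y^a)`. -/
def rescalingField (ξ : Space → ℝ) (y : Space) : Spacetime → Spacetime := fun x =>
  event 0 (-ξ (spatial x) • (spatial x - y))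

/-- The spatial trace `∑_{a=1}^3 T^{aa}`. -/
def spatialTrace (A : Matrix (Fin 4) (Fin 4) ℝ) : ℝ := ∑ a : Fin 3, A a.succ a.succ

/-- The time translation `x⁰ ↦ x⁰ + s`. -/
def timeShift (s : ℝ) : Diffeo where
  toEquiv := Equiv.addRight (event s 0)
  contMDiff_toFun := (contDiff_id.add contDiff_const).contMDiff
  contMDiff_invFun := (contDiff_id.add contDiff_const).contMDiff

section Boundary

variable {F : Type*} [NormedAddCommGroup F] [NormedSpace ℝ F]

variable (F) in
/-- Values of derivatives of order at most `k`. -/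
abbrev Jet (k : ℕ) : Type _ :=
  (i : Fin (k + 1)) → ContinuousMultilinearMap ℝ (fun _ : Fin (i : ℕ) => Spacetime) F

/-- The `k`-jet of `Ψ` at `x`. -/
def jet (k : ℕ) (Ψ : Spacetime → F) (x : Spacetime) : Jet F k :=
  fun i => iteratedFDeriv ℝ (i : ℕ) Ψ x

/-- A local functional of the field on the slice `x⁰ = 0`: the integral of a density depending
continuously on the position in space and on the `k`-jet of the field there. -/
def sliceIntegral {k : ℕ} (b : Space → Jet F k → ℝ) (Ψ : Spacetime → F) : ℝ :=
  ∫ y : Space, b y (jet k Ψ (event 0 y))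

/-- Continuous densities that vanish where the jet of the field vanishes. -/
def IsLocalDensity {k : ℕ} (b : Space → Jet F k → ℝ) : Prop :=
  (Continuous fun p : Space × Jet F k => b p.1 p.2) ∧ ∀ y, b y 0 = 0

/-- Locality of the temporal boundary term.  Let `φ` be the flow of a spatial rescaling field, which
does not vanish on the temporal boundary of `0 < x⁰ < ct`.  For solutions `Ψ` the first
variation of `S[η, φ_{ε*} Ψ; (0, ct) × ℝ³]` at `ε = 0` is then a boundary term, and it is required to
be a sum of a local functional of `Ψ` on the final slice `x⁰ = ct` (moved to `x⁰ = 0` by a time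
translation) and a local functional of `Ψ` on the initial slice `x⁰ = 0`. -/
def LocalTemporalBoundaryTerm (c : ℝ) (E : NaturalBundle F) (S : Action F) : Prop :=
  ∀ (ξ : Space → ℝ) (y : Space) (φ : ℝ → Diffeo),
    ContDiff ℝ ∞ ξ → HasCompactSupport ξ → IsFlow (rescalingField ξ y) φ →
    ∃ (k : ℕ) (b₁ b₀ : Space → Jet F k → ℝ), IsLocalDensity b₁ ∧ IsLocalDensity b₀ ∧
      ∀ Ψ : Spacetime → F, ContDiff ℝ ∞ Ψ → SpatiallyCompact Ψ → SolvesFieldEquations S Ψ →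
        ∀ t : ℝ, 0 < t →
          HasDerivAt (fun ε => S eta (E.push (φ ε) Ψ) (slab 0 (c * t)))
            (sliceIntegral b₁ (E.push (timeShift (-(c * t))) Ψ) + sliceIntegral b₀ Ψ) 0

/-- Bounded motion: for each order, the derivatives of the field on the slices `x⁰ = s`, `s ≥ 0`
(moved to `x⁰ = 0` by time translations), are bounded uniformly in `s`. -/
def BoundedMotion (E : NaturalBundle F) (Ψ : Spacetime → F) : Prop :=
  ∀ k : ℕ, ∃ C : ℝ, ∀ s : ℝ, 0 ≤ s → ∀ y : Space,
    ‖iteratedFDeriv ℝ k (E.push (timeShift (-s)) Ψ) (event 0 y)‖ ≤ C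

end Boundary

end WeakGravity

end

/-! Everything rests on computing one number in two ways: the derivative at `ε = 0` of `S[η,
φ_{ε*}Ψ; V]`, where `φ` is a flow of a vector field `X` that preserves `V`. Diffeomorphism
invariance moves the flow from the matter to the metric, `S[η, φ_*Ψ; V] = S[(φ⁻¹)_*η, Ψ; V]`, and
the Hilbert expansion then gives `(1/2c) ∫_V T^{μν} (L_X η)_{μν}` (`isBigO_push`). No
differentiability of `S` in the matter field is needed for this.

Conservation: if `X` vanishes off a compact subset of `V` and `Ψ` is a solution, the same derivative
is zero by the field equations. For `X = ψ e_ν` the integrand is `2 η_{νν} T^{μν} ∂_μ ψ` (no sum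
over `ν`), so integrating by parts and concentrating `ψ ≥ 0` near a point kills the divergence
there.

Rescaling: if `X` is the spatial contraction, exact near the support of `Ψ`, then `L_X η = diag(0,
-2, -2, -2)` there and the number is `-(1/c) ∫ ∑ T^{aa}`. Hence the anomalous term of the Newtonian
expansion equals, to first order, `S[η, φ_*Ψ] - S[η, Ψ]` and is absorbed into the background action
of the rescaled field. The Hilbert expansion holds for a fixed matter field, so it is not applied at
`φ_*Ψ`; instead `T^{00}[Ψ]` is exchanged for `T^{00}[φ_*Ψ]`, an `O(Φ)` error under a factor `Φ`.

Virial theorem: for the same flow on `(0, ct) × ℝ³` the derivative is also a sum of two slice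
functionals, bounded uniformly in `t` because the jets stay in a compact set. The time integral of
`∑ T^{aa}` is therefore bounded, and division by `t` gives the limit.

The bump and rescaling fields need complete flows by diffeomorphisms. Both reduce to an autonomous
scalar equation with compactly supported right-hand side, whose flow is shown smooth through an
explicit formula for differences of solutions. -/

namespace WeakGravity

/-! ### Smooth dependence of integrals on parameters; Hadamard and Taylor with smooth remainder. -/

section Analysis

/-- Integrals over the unit interval depend smoothly on parameters. -/
theorem contDiff_integral_unitInterval {P E : Type*} [NormedAddCommGroup P] [NormedSpace ℝ P]
    [NormedAddCommGroup E] [NormedSpace ℝ E] {n : ℕ∞} {h : P × ℝ → E}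
    (hh : ContDiff ℝ n h) : ContDiff ℝ n fun p => ∫ σ in (0 : ℝ)..1, h (p, σ) := by
  let b : ContDiffBump (0 : ℝ) := ⟨2, 3, by norm_num, by norm_num⟩
  have hb : ContDiff ℝ n b := b.contDiff
  -- The integral is the convolution, at the point `0`, of the indicator of `(0, 1]` with `z ↦ b z •
  -- h (p, -z)`. The bump `b` is `1` on `[-1, 0]` and supplies the compact support that the
  -- convolution theorem requires.
  have key := contDiffOn_convolution_right_with_param_comp (μ := (volume : Measure ℝ))
    (P := P) (n := n) (𝕜 := ℝ)
    (ContinuousLinearMap.lsmul ℝ ℝ : ℝ →L[ℝ] E →L[ℝ] E) (s := univ) (v := fun _ : P => (0 : ℝ))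
    contDiffOn_const (f := (Ioc (0 : ℝ) 1).indicator fun _ => (1 : ℝ))
    (g := fun p z => b z • h (p, -z)) (k := Metric.closedBall 0 3) isOpen_univ
    (isCompact_closedBall _ _) (fun p x _ hx => by
      have : b x = 0 := b.zero_of_le_dist (by
        rw [Metric.mem_closedBall, not_le] at hx
        exact hx.le)
      simp [this])
    ((integrable_indicator_iff measurableSet_Ioc).2 (by simp)).locallyIntegrable
    (by
      apply ContDiff.contDiffOn
      have h1 : ContDiff ℝ n fun q : P × ℝ => b q.2 := hb.comp contDiff_snd
      have h2 : ContDiff ℝ n fun q : P × ℝ => h (q.1, -q.2) :=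
        hh.comp (contDiff_fst.prodMk contDiff_snd.neg)
      exact h1.smul h2)
  rw [contDiffOn_univ] at key
  convert key using 1
  funext p
  rw [MeasureTheory.convolution, intervalIntegral.integral_of_le zero_le_one,
    ← integral_indicator measurableSet_Ioc]
  congr 1
  funext σ
  by_cases hσ : σ ∈ Ioc (0 : ℝ) 1
  · have : b (-σ) = 1 := b.one_of_mem_closedBall (by
      simp only [Metric.mem_closedBall, dist_zero_right, norm_neg, Real.norm_eq_abs, b]
      rw [abs_of_pos hσ.1]; linarith [hσ.2])
    simp [hσ, this]
  · simp [hσ]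

/-- The substitution `τ = σ t` turns the variable interval into the unit interval, at the price of a
factor `t`. -/
theorem contDiff_parametric_primitive {P E : Type*} [NormedAddCommGroup P] [NormedSpace ℝ P]
    [NormedAddCommGroup E] [NormedSpace ℝ E] {n : ℕ∞} {h : ℝ × P → E} (hh : ContDiff ℝ n h) :
    ContDiff ℝ n fun p : ℝ × P => ∫ τ in (0 : ℝ)..p.1, h (τ, p.2) := by
  have h1 : ContDiff ℝ n fun q : (ℝ × P) × ℝ => h (q.2 * q.1.1, q.1.2) := hh.comp (by fun_prop)
  have h2 := (contDiff_fst (𝕜 := ℝ) (E := ℝ) (F := P) (n := n)).smul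
    (contDiff_integral_unitInterval h1)
  convert h2 using 1
  funext p
  have := intervalIntegral.smul_integral_comp_mul_right (a := 0) (b := 1)
    (fun τ => h (τ, p.2)) p.1
  rw [zero_mul, one_mul] at this
  exact this.symm

/-- Hadamard's lemma: a smooth function vanishing at parameter `0` is divisible by the parameter. -/
theorem exists_contDiff_eq_smul {P E : Type*} [NormedAddCommGroup P] [NormedSpace ℝ P]
    [NormedAddCommGroup E] [NormedSpace ℝ E] [CompleteSpace E] {G : ℝ × P → E}
    (hG : ContDiff ℝ ∞ G) (h0 : ∀ x, G (0, x) = 0) :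
    ∃ H : ℝ × P → E, ContDiff ℝ ∞ H ∧ ∀ ε x, G (ε, x) = ε • H (ε, x) := by
  -- The quotient is the average over `σ ∈ [0, 1]` of the parameter derivative of `G` at `σ ε`.
  let D : (ℝ × P) × ℝ → E := fun q => fderiv ℝ G (q.2 * q.1.1, q.1.2) (1, 0)
  have hD : ContDiff ℝ ∞ D := by
    have h1 : ContDiff ℝ ∞ (fderiv ℝ G) := hG.fderiv_right (by simp)
    have h2 : ContDiff ℝ ∞ fun q : (ℝ × P) × ℝ => ((q.2 * q.1.1, q.1.2) : ℝ × P) := by fun_prop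
    exact (h1.comp h2).clm_apply contDiff_const
  refine ⟨fun p => ∫ σ in (0 : ℝ)..1, D (p, σ), contDiff_integral_unitInterval hD, fun ε x => ?_⟩
  have hd : ∀ σ ∈ uIcc (0 : ℝ) 1, HasDerivAt (fun σ => G (σ * ε, x)) (ε • D ((ε, x), σ)) σ := by
    intro σ _
    have h1 : HasFDerivAt G (fderiv ℝ G (σ * ε, x)) (σ * ε, x) :=
      (hG.differentiable (by simp) _).hasFDerivAt
    have h2 : HasDerivAt (fun σ : ℝ => ((σ * ε, x) : ℝ × P)) (ε, 0) σ := by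
      have := ((hasDerivAt_id σ).mul_const ε)
      simpa using this.prodMk (hasDerivAt_const σ x)
    have h3 := h1.comp_hasDerivAt σ h2
    have h4 : ((ε, 0) : ℝ × P) = ε • (1, 0) := by simp
    rw [h4, map_smul] at h3
    exact h3
  have hc : Continuous fun σ => ε • D ((ε, x), σ) := by
    have := hD.continuous
    fun_prop
  have := intervalIntegral.integral_eq_sub_of_hasDerivAt hd (hc.intervalIntegrable _ _)
  rw [intervalIntegral.integral_smul] at this
  rw [this]
  simp [h0]

/-- Second-order Taylor expansion in the parameter, with smooth remainder. -/
theorem exists_contDiff_taylor_two {P E : Type*} [NormedAddCommGroup P] [NormedSpace ℝ P]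
    [NormedAddCommGroup E] [NormedSpace ℝ E] [CompleteSpace E] {G : ℝ × P → E}
    (hG : ContDiff ℝ ∞ G) {D : P → E} (hD : ∀ x, HasDerivAt (fun ε => G (ε, x)) (D x) 0) :
    ContDiff ℝ ∞ D ∧ ∃ H : ℝ × P → E, ContDiff ℝ ∞ H ∧
      ∀ ε x, G (ε, x) = G (0, x) + ε • D x + ε ^ 2 • H (ε, x) := by
  have i0 : ContDiff ℝ ∞ fun p : ℝ × P => ((0, p.2) : ℝ × P) := by fun_prop
  have i1 : ContDiff ℝ ∞ fun p : P => ((0, p) : ℝ × P) := by fun_prop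
  obtain ⟨H₁, hH₁, e₁⟩ := exists_contDiff_eq_smul (G := fun p : ℝ × P => G p - G (0, p.2))
    (hG.sub (hG.comp i0)) (by simp)
  have hDH : ∀ x, D x = H₁ (0, x) := by
    intro x
    have h1 : HasDerivAt (fun ε : ℝ => G (0, x) + ε • H₁ (ε, x)) (H₁ (0, x)) 0 := by
      have hd : DifferentiableAt ℝ (fun ε : ℝ => H₁ (ε, x)) 0 :=
        ((hH₁.comp (contDiff_id.prodMk contDiff_const)).differentiable (by simp)) 0
      have := ((hasDerivAt_id (0 : ℝ)).smul hd.hasDerivAt).const_add (G (0, x))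
      simpa using this
    have h2 : (fun ε : ℝ => G (ε, x)) = fun ε : ℝ => G (0, x) + ε • H₁ (ε, x) := by
      funext ε
      rw [← e₁ ε x]; simp
    have h3 := hD x
    rw [h2] at h3
    exact h3.unique h1
  have hDe : D = fun x => H₁ (0, x) := funext hDH
  obtain ⟨H₂, hH₂, e₂⟩ := exists_contDiff_eq_smul (G := fun p : ℝ × P => H₁ p - H₁ (0, p.2))
    (hH₁.sub (hH₁.comp i0)) (by simp)
  refine ⟨hDe ▸ hH₁.comp i1, H₂, hH₂, fun ε x => ?_⟩
  have a := e₁ ε x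
  have b := e₂ ε x
  simp only at a b
  rw [hDH, pow_two, mul_smul, ← b, smul_sub, ← a]
  abel

end Analysis

/-! ### Smooth flows on the line. -/

section RealFlow

/-- A bounded Lipschitz vector field has global integral curves. -/
theorem exists_integralCurve_of_bounded_lipschitz {E : Type*} [NormedAddCommGroup E]
    [NormedSpace ℝ E] [CompleteSpace E] {f : E → E} {K L : NNReal} (hK : LipschitzWith K f)
    (hL : ∀ x, ‖f x‖ ≤ L) (x : E) :
    ∃ α : ℝ → E, α 0 = x ∧ ∀ t, HasDerivAt α (f (α t)) t := by
  -- The global bound `L` on the field makes Picard–Lindelöf applicable on intervals of any length: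
  -- a ball of radius `L (n + 1)` contains the curve up to time `n + 1`.
  have loc : ∀ n : ℕ, ∃ α : ℝ → E, α 0 = x ∧
      ∀ t ∈ Ioo (-(n + 1) : ℝ) (n + 1), HasDerivAt α (f (α t)) t := by
    intro n
    have h0 : (0 : ℝ) ∈ Icc (-(n + 1) : ℝ) (n + 1) := by
      constructor <;> linarith [n.cast_nonneg (α := ℝ)]
    have hp : IsPicardLindelof (fun _ => f) (⟨0, h0⟩ : Icc (-(n + 1) : ℝ) (n + 1)) x
        (L * (n + 1)) 0 L K :=
      IsPicardLindelof.of_time_independent (fun y _ => hL y) hK.lipschitzOnWith (by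
        push_cast
        simp)
    obtain ⟨α, hα0, hα⟩ := hp.exists_eq_forall_mem_Icc_hasDerivWithinAt₀
    exact ⟨α, hα0, fun t ht =>
      (hα t (Ioo_subset_Icc_self ht)).hasDerivAt (Icc_mem_nhds ht.1 ht.2)⟩
  choose β hβ0 hβ using loc
  have agree : ∀ (m n : ℕ), m ≤ n → EqOn (β m) (β n) (Ioo (-(m + 1) : ℝ) (m + 1)) := by
    intro m n hmn
    have hmn' : (m : ℝ) ≤ n := by exact_mod_cast hmn
    refine ODE_solution_unique_of_mem_Ioo (v := fun _ => f) (s := fun _ => univ) (K := K) (t₀ := 0)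
      (fun _ _ => hK.lipschitzOnWith) ?_ (fun t ht => ⟨hβ m t ht, trivial⟩)
      (fun t ht => ⟨hβ n t ⟨by linarith [ht.1], by linarith [ht.2]⟩, trivial⟩) (by simp [hβ0])
    constructor <;> linarith [m.cast_nonneg (α := ℝ)]
  have key : ∀ (n : ℕ) (t : ℝ), t ∈ Ioo (-(n + 1) : ℝ) (n + 1) → β ⌈|t|⌉₊ t = β n t := by
    intro n t ht
    have h1 : t ∈ Ioo (-((⌈|t|⌉₊ : ℕ) + 1) : ℝ) ((⌈|t|⌉₊ : ℕ) + 1) := by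
      have := Nat.le_ceil |t|
      rw [mem_Ioo, ← abs_lt]; linarith
    rcases le_total ⌈|t|⌉₊ n with h | h
    · exact agree _ _ h h1
    · exact (agree _ _ h ht).symm
  -- Gluing: the curve with index `⌈|t|⌉` is defined on an open interval of half-length `⌈|t|⌉ + 1`,
  -- hence around `t`.
  refine ⟨fun t => β ⌈|t|⌉₊ t, by simp [hβ0], fun t => ?_⟩
  have ht : t ∈ Ioo (-((⌈|t|⌉₊ : ℕ) + 1) : ℝ) ((⌈|t|⌉₊ : ℕ) + 1) := by
    have := Nat.le_ceil |t|
    rw [mem_Ioo, ← abs_lt]; linarith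
  refine (hβ _ t ht).congr_of_eventuallyEq ?_
  filter_upwards [Ioo_mem_nhds ht.1 ht.2] with u hu using key _ u hu

/-- The solution of a scalar linear equation. -/
theorem eq_mul_exp_integral_of_hasDerivAt {D a : ℝ → ℝ} (ha : Continuous a)
    (hD : ∀ t, HasDerivAt D (a t * D t) t) (t : ℝ) :
    D t = D 0 * Real.exp (∫ τ in (0 : ℝ)..t, a τ) := by
  have hI : ∀ t, HasDerivAt (fun t => ∫ τ in (0 : ℝ)..t, a τ) (a t) t := fun t =>
    intervalIntegral.integral_hasDerivAt_right (ha.intervalIntegrable _ _)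
      (ha.stronglyMeasurableAtFilter _ _) ha.continuousAt
  have hc : ∀ t, HasDerivAt (fun t => D t * Real.exp (-∫ τ in (0 : ℝ)..t, a τ)) 0 t := by
    intro t
    refine ((hD t).mul (hI t).neg.exp).congr_deriv ?_
    simp only [Pi.neg_apply]
    ring
  have := is_const_of_deriv_eq_zero (fun t => (hc t).differentiableAt) (fun t => (hc t).deriv) t 0
  simp only [intervalIntegral.integral_same, neg_zero, Real.exp_zero, mul_one] at this
  rw [← this, mul_assoc, ← Real.exp_add]
  simp

/-- The divided difference `∫₀¹ f'(u + σ (v - u)) dσ`. -/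
noncomputable def dividedDifference (f : ℝ → ℝ) (p : ℝ × ℝ) : ℝ :=
  ∫ σ in (0 : ℝ)..1, deriv f (p.1 + σ * (p.2 - p.1))

theorem contDiff_dividedDifference {f : ℝ → ℝ} (hf : ContDiff ℝ ∞ f) :
    ContDiff ℝ ∞ (dividedDifference f) := by
  have h1 : ContDiff ℝ ∞ (deriv f) := (contDiff_infty_iff_deriv.1 hf).2
  have h2 : ContDiff ℝ ∞ fun q : (ℝ × ℝ) × ℝ => deriv f (q.1.1 + q.2 * (q.1.2 - q.1.1)) :=
    h1.comp (by fun_prop)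
  exact contDiff_integral_unitInterval h2

theorem sub_eq_dividedDifference_mul {f : ℝ → ℝ} (hf : ContDiff ℝ ∞ f) (u v : ℝ) :
    f v - f u = dividedDifference f (u, v) * (v - u) := by
  have hd : ∀ σ ∈ uIcc (0 : ℝ) 1, HasDerivAt (fun σ => f (u + σ * (v - u)))
      (deriv f (u + σ * (v - u)) * (v - u)) σ := by
    intro σ _
    have h1 : HasDerivAt (fun σ : ℝ => u + σ * (v - u)) (v - u) σ := by
      simpa using ((hasDerivAt_id σ).mul_const (v - u)).const_add u
    exact ((hf.differentiable (by simp)) _).hasDerivAt.comp σ h1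
  have hc : Continuous fun σ => deriv f (u + σ * (v - u)) * (v - u) := by
    have : Continuous (deriv f) := ((contDiff_infty_iff_deriv.1 hf).2).continuous
    fun_prop
  have := intervalIntegral.integral_eq_sub_of_hasDerivAt hd (hc.intervalIntegrable _ _)
  rw [intervalIntegral.integral_mul_const] at this
  simp only [one_mul, zero_mul, add_zero] at this
  rw [dividedDifference, this]
  simp

/-- Compactly supported smooth vector fields on the line have complete smooth flows. -/
theorem exists_smooth_flow_real {f : ℝ → ℝ} (hf : ContDiff ℝ ∞ f) (hc : HasCompactSupport f) :
    ∃ θ : ℝ × ℝ → ℝ, ContDiff ℝ ∞ θ ∧ (∀ s, θ (0, s) = s) ∧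
      ∀ t s, HasDerivAt (fun t => θ (t, s)) (f (θ (t, s))) t := by
  obtain ⟨K, hK⟩ := hf.lipschitzWith_of_hasCompactSupport hc (by simp)
  obtain ⟨L, hL⟩ := hc.exists_bound_of_continuous hf.continuous
  have hL' : ∀ x, ‖f x‖ ≤ (⟨max L 0, le_max_right _ _⟩ : NNReal) :=
    fun x => (hL x).trans (le_max_left _ _)
  choose α hα0 hα using exists_integralCurve_of_bounded_lipschitz hK hL'
  have hαc : ∀ s, Continuous (α s) := fun s =>
    continuous_iff_continuousAt.2 fun t => (hα s t).continuousAt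
  have hm := contDiff_dividedDifference hf
  have hmK : ∀ p, |dividedDifference f p| ≤ K := by
    intro p
    have := intervalIntegral.norm_integral_le_of_norm_le_const (a := 0) (b := 1) (C := K)
      (f := fun σ => deriv f (p.1 + σ * (p.2 - p.1)))
      (fun x _ => norm_deriv_le_of_lipschitz hK)
    simpa [dividedDifference] using this
  -- The difference of two solutions satisfies a scalar linear equation whose coefficient is the
  -- divided difference of `f`, so it is an explicit exponential. Lipschitz dependence on the
  -- initial value and the derivative in it are both read off from this formula.
  have hdiff : ∀ t s s', α s' t - α s t = (s' - s) *
      Real.exp (∫ τ in (0 : ℝ)..t, dividedDifference f (α s τ, α s' τ)) := by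
    intro t s s'
    have := eq_mul_exp_integral_of_hasDerivAt (D := fun t => α s' t - α s t)
      (a := fun τ => dividedDifference f (α s τ, α s' τ))
      (hm.continuous.comp ((hαc s).prodMk (hαc s'))) (fun t => by
        rw [← sub_eq_dividedDifference_mul hf]
        exact (hα s' t).sub (hα s t)) t
    simpa [hα0] using this
  have hlip : ∀ t s s', |α s' t - α s t| ≤ |s' - s| * Real.exp (K * |t|) := by
    intro t s s'
    rw [hdiff, abs_mul, Real.abs_exp]
    gcongr
    refine (le_abs_self _).trans ?_
    simpa using intervalIntegral.norm_integral_le_of_norm_le_const (a := 0) (b := t) (C := K)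
      (f := fun τ => dividedDifference f (α s τ, α s' τ)) (fun x _ => hmK _)
  let θ : ℝ × ℝ → ℝ := fun p => α p.2 p.1
  have hθc : Continuous θ := by
    refine continuous_iff_continuousAt.2 fun p => ?_
    have h1 : Tendsto (fun q : ℝ × ℝ => |q.2 - p.2| * Real.exp (K * |q.1|) +
        |α p.2 q.1 - α p.2 p.1|) (𝓝 p) (𝓝 0) := by
      have hα' := hαc p.2
      have : Continuous fun q : ℝ × ℝ => |q.2 - p.2| * Real.exp (K * |q.1|) +
        |α p.2 q.1 - α p.2 p.1| := by fun_prop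
      simpa using this.tendsto p
    refine tendsto_iff_norm_sub_tendsto_zero.2
      (squeeze_zero (fun _ => norm_nonneg _) (fun q => ?_) h1)
    calc ‖α q.2 q.1 - α p.2 p.1‖ = |(α q.2 q.1 - α p.2 q.1) + (α p.2 q.1 - α p.2 p.1)| := by
          rw [Real.norm_eq_abs]; congr 1; ring
      _ ≤ _ := (abs_add_le _ _).trans (by gcongr; exact hlip _ _ _)
  have hEc : Continuous fun q : ℝ × ℝ × ℝ =>
      ∫ τ in (0 : ℝ)..q.1, dividedDifference f (θ (τ, q.2.1), θ (τ, q.2.2)) := by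
    have hm' := hm.continuous
    refine intervalIntegral.continuous_parametric_intervalIntegral_of_continuous
      (f := fun (q : ℝ × ℝ × ℝ) τ => dividedDifference f (θ (τ, q.2.1), θ (τ, q.2.2))) ?_ continuous_fst
    simp only [Function.uncurry_def]
    fun_prop
  -- On the diagonal the divided difference is `f'`, so `e` is the limit of the difference quotients
  -- in `s`.
  let g : ℝ → ℝ := fun u => dividedDifference f (u, u)
  have hg : ContDiff ℝ ∞ g := hm.comp (by fun_prop)
  let e : ℝ × ℝ → ℝ := fun p => Real.exp (∫ τ in (0 : ℝ)..p.1, g (θ (τ, p.2)))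
  have hec : Continuous e :=
    Real.continuous_exp.comp (hEc.comp
      (continuous_fst.prodMk (continuous_snd.prodMk continuous_snd)))
  have hs : ∀ t s, HasDerivAt (fun s => θ (t, s)) (e (t, s)) s := by
    intro t s
    rw [hasDerivAt_iff_tendsto_slope]
    have h1 : Continuous fun s' : ℝ => Real.exp (∫ τ in (0 : ℝ)..t,
        dividedDifference f (θ (τ, s), θ (τ, s'))) :=
      Real.continuous_exp.comp (hEc.comp
        (continuous_const.prodMk (continuous_const.prodMk continuous_id)))
    refine ((h1.tendsto s).mono_left nhdsWithin_le_nhds).congr' ?_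
    filter_upwards [self_mem_nhdsWithin] with s' hs'
    have : s' - s ≠ 0 := sub_ne_zero.2 hs'
    rw [slope_def_field, eq_div_iff this, hdiff t s s', mul_comm]
  have hfd : ∀ p : ℝ × ℝ, HasFDerivAt θ
      (f (θ p) • ContinuousLinearMap.fst ℝ ℝ ℝ + e p • ContinuousLinearMap.snd ℝ ℝ ℝ) p := by
    intro p
    have hfc := hf.continuous
    have := hasStrictFDerivAt_uncurry_coprod (𝕜 := ℝ) (u := p) (f := fun t s => θ (t, s))
      (f₁ := fun t s => ContinuousLinearMap.toSpanSingleton ℝ (f (θ (t, s))))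
      (f₂ := fun t s => ContinuousLinearMap.toSpanSingleton ℝ (e (t, s)))
      (Eventually.of_forall fun q => (hα q.2 q.1).hasFDerivAt)
      (Eventually.of_forall fun q => (hs q.1 q.2).hasFDerivAt)
      (Continuous.continuousAt (by
        have h := (ContinuousLinearMap.toSpanSingletonCLE (𝕜 := ℝ) (E := ℝ)).continuous.comp
          (hfc.comp hθc)
        exact h))
      (Continuous.continuousAt (by
        have h := (ContinuousLinearMap.toSpanSingletonCLE (𝕜 := ℝ) (E := ℝ)).continuous.comp hec
        exact h))
    convert! this.hasFDerivAt using 1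
    ext <;> simp [Function.HasUncurry.uncurry]
  -- Bootstrap: both partial derivatives, `f ∘ θ` and `e`, are as regular as `θ`, so `θ` gains one
  -- derivative at each step.
  have hn : ∀ n : ℕ, ContDiff ℝ n θ := by
    intro n
    induction n with
    | zero => exact contDiff_zero.2 hθc
    | succ n ih =>
      rw [Nat.cast_succ, contDiff_succ_iff_hasFDerivAt]
      refine ⟨_, ?_, hfd⟩
      have h1 : ContDiff ℝ n fun p => f (θ p) := (hf.of_le (by exact_mod_cast le_top)).comp ih
      have h2 : ContDiff ℝ n e := (contDiff_parametric_primitive (n := n) (h := fun p => g (θ p))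
        ((hg.of_le (by exact_mod_cast le_top)).comp ih)).exp
      exact (h1.smul contDiff_const).add (h2.smul contDiff_const)
  exact ⟨θ, contDiff_infty.2 hn, hα0, fun t s => hα s t⟩

end RealFlow

/-! ### Flows on spacetime: uniqueness, group law, bump fields and rescaling fields. -/

section Flows

theorem contDiff_spatial {n : WithTop ℕ∞} : ContDiff ℝ n spatial :=
  contDiff_pi.2 fun a => contDiff_apply ℝ ℝ a.succ

theorem contDiff_event {n : WithTop ℕ∞} : ContDiff ℝ n fun p : ℝ × Space => event p.1 p.2 := by
  refine contDiff_pi.2 fun μ => ?_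
  refine Fin.cases ?_ (fun a => ?_) μ
  · simpa [event] using contDiff_fst
  · exact (contDiff_apply ℝ ℝ a).comp contDiff_snd

@[simp] theorem event_zero (s : ℝ) (y : Space) : event s y 0 = s := rfl

@[simp] theorem event_succ (s : ℝ) (y : Space) (a : Fin 3) : event s y a.succ = y a := rfl

@[simp] theorem spatial_event (s : ℝ) (y : Space) : spatial (event s y) = y := rfl

theorem event_spatial (x : Spacetime) : event (x 0) (spatial x) = x := by
  funext μ
  exact Fin.cases rfl (fun a => rfl) μ

theorem continuous_spatial : Continuous spatial := (contDiff_spatial (n := 0)).continuous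

theorem Diffeo.contDiff (φ : Diffeo) : ContDiff ℝ ∞ φ := φ.contMDiff.contDiff

/-- Integral curves of a `C¹` vector field are unique. -/
theorem eqOn_Ioo_of_integralCurve {E : Type*} [NormedAddCommGroup E] [NormedSpace ℝ E]
    [ProperSpace E] {X : E → E} (hX : ContDiff ℝ 1 X) {α β : ℝ → E}
    {a b t₀ : ℝ} (h₀ : t₀ ∈ Ioo a b) (hα : ∀ t ∈ Ioo a b, HasDerivAt α (X (α t)) t)
    (hβ : ∀ t ∈ Ioo a b, HasDerivAt β (X (β t)) t) (h : α t₀ = β t₀) : EqOn α β (Ioo a b) := by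
  intro t ht
  -- A `C¹` field is Lipschitz only on bounded sets. On a compact subinterval containing `t₀` and
  -- `t` both curves stay in one ball, where the Lipschitz uniqueness theorem applies.
  obtain ⟨a', ha', ha''⟩ := exists_between (lt_min h₀.1 ht.1)
  obtain ⟨b', hb', hb''⟩ := exists_between (max_lt h₀.2 ht.2)
  have hsub : Icc a' b' ⊆ Ioo a b := fun u hu => ⟨ha'.trans_le hu.1, hu.2.trans_lt hb''⟩
  have hcα : ContinuousOn α (Icc a' b') := HasDerivAt.continuousOn fun u hu => hα u (hsub hu)
  have hcβ : ContinuousOn β (Icc a' b') := HasDerivAt.continuousOn fun u hu => hβ u (hsub hu)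
  obtain ⟨R, hR⟩ := (((isCompact_Icc.image_of_continuousOn hcα).union
    (isCompact_Icc.image_of_continuousOn hcβ)).isBounded).subset_closedBall 0
  obtain ⟨K, hK⟩ := (hX.contDiffOn (s := Metric.closedBall (0 : E) R)).exists_lipschitzOnWith
    one_ne_zero (convex_closedBall _ _) (isCompact_closedBall _ _)
  refine ODE_solution_unique_of_mem_Ioo (v := fun _ => X) (s := fun _ => Metric.closedBall 0 R)
    (K := K) (fun _ _ => hK) (t₀ := t₀) (a := a') (b := b')
    ⟨ha''.trans_le (min_le_left _ _), (le_max_left _ _).trans_lt hb'⟩ (fun u hu => ?_)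
    (fun u hu => ?_) h ⟨ha''.trans_le (min_le_right _ _), (le_max_right _ _).trans_lt hb'⟩
  · have hu' := Ioo_subset_Icc_self hu
    exact ⟨hα u (hsub hu'), hR (Or.inl ⟨u, hu', rfl⟩)⟩
  · have hu' := Ioo_subset_Icc_self hu
    exact ⟨hβ u (hsub hu'), hR (Or.inr ⟨u, hu', rfl⟩)⟩

theorem eq_of_integralCurve {E : Type*} [NormedAddCommGroup E] [NormedSpace ℝ E]
    [ProperSpace E] {X : E → E} (hX : ContDiff ℝ 1 X) {α β : ℝ → E}
    (hα : ∀ t, HasDerivAt α (X (α t)) t) (hβ : ∀ t, HasDerivAt β (X (β t)) t)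
    (h : α 0 = β 0) (t : ℝ) : α t = β t :=
  eqOn_Ioo_of_integralCurve hX (a := -(|t| + 1)) (b := |t| + 1)
    ⟨by linarith [abs_nonneg t], by linarith [abs_nonneg t]⟩ (fun u _ => hα u) (fun u _ => hβ u) h
    ⟨by linarith [neg_abs_le t], by linarith [le_abs_self t]⟩

/-- A smooth map satisfying the flow equation satisfies the group law. -/
theorem flow_add {X : Spacetime → Spacetime} (hX : ContDiff ℝ 1 X) {Φ : ℝ → Spacetime → Spacetime}
    (h0 : ∀ x, Φ 0 x = x) (hΦ : ∀ t x, HasDerivAt (fun s => Φ s x) (X (Φ t x)) t)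
    (s t : ℝ) (x : Spacetime) : Φ (s + t) x = Φ s (Φ t x) := by
  refine eq_of_integralCurve hX (α := fun s => Φ (s + t) x) (β := fun s => Φ s (Φ t x))
    (fun u => ?_) (fun u => hΦ u _) (by simp [h0]) s
  exact (hΦ (u + t) x).comp_add_const u t

/-- A smooth solution of the flow equation is the flow by diffeomorphisms. -/
theorem exists_isFlow {X : Spacetime → Spacetime} (hX : ContDiff ℝ 1 X)
    {Φ : ℝ × Spacetime → Spacetime} (hs : ContDiff ℝ ∞ Φ) (h0 : ∀ x, Φ (0, x) = x)
    (hΦ : ∀ t x, HasDerivAt (fun s => Φ (s, x)) (X (Φ (t, x))) t) :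
    ∃ φ : ℝ → Diffeo, IsFlow X φ ∧ ∀ t x, φ t x = Φ (t, x) := by
  have hadd := flow_add hX (Φ := fun t x => Φ (t, x)) h0 hΦ
  have hslice : ∀ t, ContDiff ℝ ∞ fun x => Φ (t, x) := fun t =>
    hs.comp (contDiff_const.prodMk contDiff_id)
  let φ : ℝ → Diffeo := fun t =>
    { toFun := fun x => Φ (t, x)
      invFun := fun x => Φ (-t, x)
      left_inv := fun x => (hadd (-t) t x).symm.trans (by simp [h0])
      right_inv := fun x => (hadd t (-t) x).symm.trans (by simp [h0])
      contMDiff_toFun := (hslice t).contMDiff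
      contMDiff_invFun := (hslice (-t)).contMDiff }
  exact ⟨φ, ⟨hs, h0, hΦ⟩, fun _ _ => rfl⟩

namespace IsFlow

variable {X : Spacetime → Spacetime} {φ : ℝ → Diffeo}

/-- The field is the time derivative at `0` of the jointly smooth flow map, so it inherits
smoothness from it. -/
theorem contDiff_field (h : IsFlow X φ) : ContDiff ℝ ∞ X := by
  have h1 : ∀ x, X x = fderiv ℝ (fun p : ℝ × Spacetime => φ p.1 p.2) (0, x) (1, 0) := by
    intro x
    have h2 : HasDerivAt (fun t : ℝ => ((t, x) : ℝ × Spacetime)) (1, 0) 0 :=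
      (hasDerivAt_id (0 : ℝ)).prodMk (hasDerivAt_const _ _)
    have h3 := ((h.smooth.differentiable (by simp)) (0, x)).hasFDerivAt.comp_hasDerivAt 0 h2
    have h4 := h.deriv 0 x
    rw [h.zero] at h4
    exact h4.unique h3
  rw [funext h1]
  exact ((h.smooth.fderiv_right (m := ∞) (by simp)).comp
    (contDiff_const.prodMk contDiff_id)).clm_apply contDiff_const

theorem add (h : IsFlow X φ) (s t : ℝ) (x : Spacetime) : φ (s + t) x = φ s (φ t x) :=
  flow_add (h.contDiff_field.of_le (by simp)) (Φ := fun t x => φ t x) h.zero h.deriv s t x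

theorem symm_apply (h : IsFlow X φ) (t : ℝ) (x : Spacetime) : (φ t).symm x = φ (-t) x := by
  have h1 : φ t (φ (-t) x) = x := by rw [← h.add]; simp [h.zero]
  conv_lhs => rw [← h1]
  exact (φ t).symm_apply_apply _

theorem eq_self (h : IsFlow X φ) {x : Spacetime} (hx : X x = 0) (t : ℝ) : φ t x = x := by
  refine eq_of_integralCurve (h.contDiff_field.of_le (by simp)) (α := fun t => φ t x)
    (β := fun _ => x) (h.deriv · x) (fun t => ?_) (h.zero x) t
  rw [hx]
  exact hasDerivAt_const _ _

/-- Points off `K` are stationary. An orbit from `V` that met the complement of `V` would be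
stationary there, hence could not have started in `V`. -/
theorem image_eq (h : IsFlow X φ) {K V : Set Spacetime} (hKV : K ⊆ V) (hX : ∀ x ∉ K, X x = 0)
    (t : ℝ) : φ t '' V = V := by
  have key : ∀ t, ∀ x ∈ V, φ t x ∈ V := by
    intro t x hx
    by_contra hn
    have h1 := h.eq_self (hX _ fun hk => hn (hKV hk)) (-t)
    rw [← h.add, neg_add_cancel, h.zero] at h1
    exact hn (h1 ▸ hx)
  refine Subset.antisymm (image_subset_iff.2 (key t)) fun x hx => ⟨φ (-t) x, key _ x hx, ?_⟩
  rw [← h.add]; simp [h.zero]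

end IsFlow

/-- Around every point there is a small bump function whose multiple of a given coordinate field
has a complete flow. -/
theorem exists_bump_isFlow (x₀ : Spacetime) (ν : Fin 4) {δ : ℝ} (hδ : 0 < δ) :
    ∃ (ψ : Spacetime → ℝ) (φ : ℝ → Diffeo), ContDiff ℝ ∞ ψ ∧ (∀ x, 0 ≤ ψ x) ∧ 0 < ψ x₀ ∧
      (∀ x ∉ Metric.closedBall x₀ δ, ψ x = 0) ∧ IsFlow (fun x => Pi.single ν (ψ x)) φ := by
  let b : (μ : Fin 4) → ContDiffBump (x₀ μ) := fun μ => ⟨δ / 2, δ, by positivity, by linarith⟩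
  obtain ⟨θ, hθ, hθ0, hθd⟩ := exists_smooth_flow_real (b ν).contDiff
    (b ν).hasCompactSupport
  let g : Spacetime → ℝ := fun x => ∏ μ ∈ Finset.univ.erase ν, b μ (x μ)
  let ψ : Spacetime → ℝ := fun x => ∏ μ, b μ (x μ)
  have hψg : ∀ x, ψ x = b ν (x ν) * g x := fun x =>
    (Finset.mul_prod_erase Finset.univ (fun μ => b μ (x μ)) (Finset.mem_univ ν)).symm
  have hbs : ∀ μ, ContDiff ℝ ∞ fun x : Spacetime => b μ (x μ) := fun μ =>
    (b μ).contDiff.comp (contDiff_apply ℝ ℝ μ)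
  have hg : ContDiff ℝ ∞ g := contDiff_prod fun μ _ => hbs μ
  have hψ : ContDiff ℝ ∞ ψ := contDiff_prod fun μ _ => hbs μ
  -- Moving along `e_ν` leaves `g` unchanged, so the flow is the one-dimensional flow of `b ν` run
  -- at the constant speed `g`.
  let Φ : ℝ × Spacetime → Spacetime := fun p => Function.update p.2 ν (θ (p.1 * g p.2, p.2 ν))
  have hgΦ : ∀ p, g (Φ p) = g p.2 := fun p => Finset.prod_congr rfl fun μ hμ => by
    simp [Φ, Function.update_of_ne (Finset.ne_of_mem_erase hμ)]
  have hΦs : ContDiff ℝ ∞ Φ := by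
    refine contDiff_pi.2 fun μ => ?_
    by_cases hμ : μ = ν
    · subst hμ
      simp only [Φ, Function.update_self]
      exact hθ.comp ((contDiff_fst.mul (hg.comp contDiff_snd)).prodMk
        ((contDiff_apply ℝ ℝ μ).comp contDiff_snd))
    · simp only [Φ, Function.update_of_ne hμ]
      exact (contDiff_apply ℝ ℝ μ).comp contDiff_snd
  have hX : ContDiff ℝ ∞ fun x => (Pi.single ν (ψ x) : Spacetime) :=
    (ContinuousLinearMap.single ℝ (fun _ : Fin 4 => ℝ) ν).contDiff.comp hψ
  obtain ⟨φ, hφ, -⟩ := exists_isFlow (hX.of_le (by simp)) hΦs (fun x => by simp [Φ, hθ0])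
    (fun t x => by
      refine hasDerivAt_pi.2 fun μ => ?_
      by_cases hμ : μ = ν
      · subst hμ
        rw [Pi.single_eq_same, hψg, hgΦ]
        simp only [Φ, Function.update_self]
        exact (hθd (t * g x) (x μ)).comp t (hasDerivAt_mul_const (g x))
      · rw [Pi.single_eq_of_ne hμ]
        simp only [Φ, Function.update_of_ne hμ]
        exact hasDerivAt_const _ _)
  refine ⟨ψ, φ, hψ, fun x => Finset.prod_nonneg fun μ _ => (b μ).nonneg,
    Finset.prod_pos fun μ _ => (b μ).pos_of_mem_ball (Metric.mem_ball_self hδ), fun x hx => ?_, hφ⟩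
  rw [Metric.mem_closedBall, dist_pi_le_iff hδ.le] at hx
  push Not at hx
  obtain ⟨μ, hμ⟩ := hx
  exact Finset.prod_eq_zero (Finset.mem_univ μ) ((b μ).zero_of_le_dist hμ.le)

/-- Spatial rescaling fields that are exact on a given ball and have complete flows, preserving
the time slices. -/
theorem exists_rescaling_isFlow (y : Space) (R : ℝ) :
    ∃ (ξ : Space → ℝ) (φ : ℝ → Diffeo), ContDiff ℝ ∞ ξ ∧ HasCompactSupport ξ ∧
      (∀ z ∈ Metric.closedBall y R, ξ z = 1) ∧ IsFlow (rescalingField ξ y) φ ∧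
      ∀ t x, φ t x 0 = x 0 := by
  -- The norm on `Space` is the supremum norm, so on the ball of radius `R` the sum of three squares
  -- `q` is at most `3 R²`. Cutting off in `q` keeps the field radial: `q` then obeys the closed
  -- equation `v' = -2 χ(v) v`.
  let χ : ContDiffBump (0 : ℝ) :=
    ⟨3 * R ^ 2 + 1, 3 * R ^ 2 + 2, by positivity, by linarith⟩
  have hχ : ContDiff ℝ ∞ χ := χ.contDiff
  let q : Space → ℝ := fun z => ∑ a, (z a - y a) ^ 2
  have hq : ContDiff ℝ ∞ q := by
    refine ContDiff.sum fun a _ => ?_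
    have := contDiff_apply ℝ ℝ (n := ∞) a
    fun_prop
  have hq0 : ∀ z, 0 ≤ q z := fun z => Finset.sum_nonneg fun a _ => sq_nonneg _
  have hf : ContDiff ℝ ∞ fun v : ℝ => -2 * χ v * v := by fun_prop
  have hfc : HasCompactSupport fun v : ℝ => -2 * χ v * v :=
    (χ.hasCompactSupport.mul_left (f := fun _ => (-2 : ℝ))).mul_right
  obtain ⟨θ, hθ, hθ0, hθd⟩ := exists_smooth_flow_real hf hfc
  let I : ℝ × ℝ → ℝ := fun p => ∫ τ in (0 : ℝ)..p.1, χ (θ (τ, p.2))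
  have hI : ContDiff ℝ ∞ I := contDiff_parametric_primitive (h := fun p => χ (θ p)) (hχ.comp hθ)
  have hcθ : ∀ v, Continuous fun τ => χ (θ (τ, v)) := fun v =>
    hχ.continuous.comp (hθ.continuous.comp (by fun_prop))
  have hId : ∀ t v, HasDerivAt (fun t => I (t, v)) (χ (θ (t, v))) t := fun t v =>
    intervalIntegral.integral_hasDerivAt_right ((hcθ v).intervalIntegrable _ _)
      ((hcθ v).stronglyMeasurableAtFilter _ _) (hcθ v).continuousAt
  have hθI : ∀ t v, θ (t, v) = v * Real.exp (-2 * I (t, v)) := by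
    intro t v
    have := eq_mul_exp_integral_of_hasDerivAt (D := fun t => θ (t, v))
      (a := fun τ => -2 * χ (θ (τ, v))) (continuous_const.mul (hcθ v)) (fun t => hθd t v) t
    rw [intervalIntegral.integral_const_mul, hθ0] at this
    exact this
  let ξ : Space → ℝ := fun z => χ (q z)
  have hξ : ContDiff ℝ ∞ ξ := hχ.comp hq
  have hX : ContDiff ℝ ∞ (rescalingField ξ y) := by
    have h1 := hξ.comp (contDiff_spatial (n := ∞))
    have h2 : ContDiff ℝ ∞ fun x : Spacetime => -ξ (spatial x) • (spatial x - y) :=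
      h1.neg.smul (contDiff_spatial.sub contDiff_const)
    exact contDiff_event.comp ((contDiff_const (c := (0 : ℝ))).prodMk h2)
  -- Once `q` is known along the orbit, the displacement from `y` solves a linear equation and
  -- shrinks by `exp (-∫ χ)`.
  let u : ℝ × Spacetime → Space := fun p =>
    y + Real.exp (-I (p.1, q (spatial p.2))) • (spatial p.2 - y)
  have hu : ContDiff ℝ ∞ u := by
    have h1 : ContDiff ℝ ∞ fun p : ℝ × Spacetime => I (p.1, q (spatial p.2)) :=
      hI.comp (contDiff_fst.prodMk (hq.comp (contDiff_spatial.comp contDiff_snd)))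
    exact contDiff_const.add (h1.neg.exp.smul
      ((contDiff_spatial.comp contDiff_snd).sub contDiff_const))
  have hqu : ∀ p : ℝ × Spacetime, q (u p) = θ (p.1, q (spatial p.2)) := by
    intro p
    rw [hθI, show -2 * I (p.1, q (spatial p.2))
      = -I (p.1, q (spatial p.2)) + -I (p.1, q (spatial p.2)) by ring, Real.exp_add]
    simp only [q, u, Pi.add_apply, Pi.smul_apply, Pi.sub_apply, smul_eq_mul, Finset.sum_mul]
    exact Finset.sum_congr rfl fun a _ => by ring
  obtain ⟨φ, hφ, hφe⟩ := exists_isFlow (hX.of_le (by simp))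
    (Φ := fun p => event (p.2 0) (u p))
    (contDiff_event.comp (((contDiff_apply ℝ ℝ (0 : Fin 4)).comp contDiff_snd).prodMk hu))
    (fun x => by simp [u, I, event_spatial])
    (fun t x => by
      have h1 : HasDerivAt (fun s => u (s, x)) (-ξ (u (t, x)) • (u (t, x) - y)) t := by
        have h2 := ((hId t (q (spatial x))).neg.exp.smul_const (spatial x - y)).const_add y
        refine h2.congr_deriv ?_
        simp only [ξ, hqu]
        simp only [u, add_sub_cancel_left, smul_smul]
        congr 1
        simp only [Pi.neg_apply]
        ring
      refine hasDerivAt_pi.2 fun μ => ?_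
      refine Fin.cases ?_ (fun a => ?_) μ
      · exact hasDerivAt_const _ _
      · exact hasDerivAt_pi.1 h1 a)
  refine ⟨ξ, φ, hξ, ?_, fun z hz => ?_, hφ, fun t x => by rw [hφe]; rfl⟩
  · refine HasCompactSupport.intro (isCompact_closedBall y (3 * R ^ 2 + 2)) fun z hz => ?_
    rw [Metric.mem_closedBall, dist_pi_le_iff (by positivity)] at hz
    push Not at hz
    obtain ⟨a, ha⟩ := hz
    refine χ.zero_of_le_dist ?_
    rw [dist_zero_right, Real.norm_of_nonneg (hq0 z)]
    have h1 : (z a - y a) ^ 2 ≤ q z :=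
      Finset.single_le_sum (f := fun a => (z a - y a) ^ 2) (fun a _ => sq_nonneg _)
        (Finset.mem_univ a)
    rw [Real.dist_eq] at ha
    have h2 := sq_abs (z a - y a)
    show 3 * R ^ 2 + 2 ≤ q z
    nlinarith [sq_nonneg R]
  · refine χ.one_of_mem_closedBall ?_
    rw [Metric.mem_closedBall, dist_zero_right, Real.norm_of_nonneg (hq0 z)]
    have hR : 0 ≤ R := dist_nonneg.trans hz
    rw [Metric.mem_closedBall, dist_pi_le_iff hR] at hz
    have h1 : ∀ a, (z a - y a) ^ 2 ≤ R ^ 2 := fun a => by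
      have := hz a
      rw [Real.dist_eq] at this
      exact sq_le_sq' (by linarith [neg_abs_le (z a - y a)]) ((le_abs_self _).trans this)
    have h2 : q z ≤ ∑ _a : Fin 3, R ^ 2 := Finset.sum_le_sum fun a _ => h1 a
    simp at h2
    show q z ≤ 3 * R ^ 2 + 1
    linarith

/-- Where the cut-off is `1` the flow of a rescaling field is the rescaling. -/
theorem rescaling_flow_eq {ξ : Space → ℝ} {y : Space} {R : ℝ}
    (hξ : ∀ z ∈ Metric.closedBall y R, ξ z = 1) {φ : ℝ → Diffeo}
    (hφ : IsFlow (rescalingField ξ y) φ) {x : Spacetime}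
    (hx : spatial x ∈ Metric.closedBall y (R / 3)) {t : ℝ} (ht : |t| < 1) :
    φ t x = event (x 0) (y + Real.exp (-t) • (spatial x - y)) := by
  have hR : 0 ≤ R := by have := dist_nonneg.trans (Metric.mem_closedBall.1 hx); linarith
  refine eqOn_Ioo_of_integralCurve (hφ.contDiff_field.of_le (by simp)) (t₀ := 0) (a := -1) (b := 1)
    (α := fun t => φ t x) (β := fun t => event (x 0) (y + Real.exp (-t) • (spatial x - y)))
    (by simp) (fun t _ => hφ.deriv t x) (fun t ht => ?_) (by simp [hφ.zero, event_spatial])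
    (abs_lt.1 ht)
  -- For `|t| < 1` the factor is below `e < 3`, so an orbit from the ball of radius `R / 3` stays
  -- where the cut-off is `1`.
  have h1 : y + Real.exp (-t) • (spatial x - y) ∈ Metric.closedBall y R := by
    rw [Metric.mem_closedBall, dist_eq_norm] at hx ⊢
    rw [add_sub_cancel_left, norm_smul, Real.norm_eq_abs, Real.abs_exp]
    have h2 : Real.exp (-t) ≤ 3 :=
      (Real.exp_le_exp.2 (by linarith [ht.1])).trans (Real.exp_one_lt_d9.le.trans (by norm_num))
    nlinarith [norm_nonneg (spatial x - y), Real.exp_pos (-t)]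
  have h3 : HasDerivAt (fun t => y + Real.exp (-t) • (spatial x - y))
      (-Real.exp (-t) • (spatial x - y)) t := by
    have h4 := (((hasDerivAt_id t).neg.exp).smul_const (spatial x - y)).const_add y
    refine h4.congr_deriv ?_
    simp
  refine hasDerivAt_pi.2 fun μ => ?_
  simp only [rescalingField, spatial_event, hξ _ h1, add_sub_cancel_left]
  refine Fin.cases ?_ (fun a => ?_) μ
  · exact hasDerivAt_const _ _
  · refine (hasDerivAt_pi.1 h3 a).congr_deriv ?_
    simp

end Flows

/-! ### Pushforward of metrics and its first variation. -/

section Tensors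

theorem jacobian_eq_toMatrix (f : Spacetime → Spacetime) (x : Spacetime) :
    jacobian f x = LinearMap.toMatrix' (fderiv ℝ f x : Spacetime →ₗ[ℝ] Spacetime) := by
  ext μ ν
  rw [LinearMap.toMatrix'_apply]
  rfl

theorem jacobian_id (x : Spacetime) : jacobian (fun x => x) x = 1 := by
  rw [jacobian_eq_toMatrix, fderiv_fun_id]
  exact LinearMap.toMatrix'_id

theorem jacobian_comp {f g : Spacetime → Spacetime} {x : Spacetime}
    (hf : DifferentiableAt ℝ f (g x)) (hg : DifferentiableAt ℝ g x) :
    jacobian (fun z => f (g z)) x = jacobian f (g x) * jacobian g x := by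
  simp only [jacobian_eq_toMatrix]
  rw [fderiv_fun_comp x hf hg, ← LinearMap.toMatrix'_comp]
  rfl

theorem Diffeo.differentiableAt (φ : Diffeo) (x : Spacetime) : DifferentiableAt ℝ φ x :=
  (φ.contDiff.differentiable (by simp)) x

theorem jacobian_mul_jacobian_symm (φ : Diffeo) (x : Spacetime) :
    jacobian φ (φ.symm x) * jacobian φ.symm x = 1 := by
  rw [← jacobian_comp (φ.differentiableAt _) (Diffeo.differentiableAt φ.symm x), ← jacobian_id x]
  congr 1
  funext z
  exact φ.apply_symm_apply z

theorem jacobian_symm_mul_jacobian (φ : Diffeo) (x : Spacetime) :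
    jacobian φ.symm x * jacobian φ (φ.symm x) = 1 :=
  mul_eq_one_comm.1 (jacobian_mul_jacobian_symm φ x)

theorem pushTensor_pushTensor_symm (φ : Diffeo) (g : TensorField) :
    pushTensor φ (pushTensor φ.symm g) = g := by
  funext x
  have h1 := jacobian_mul_jacobian_symm φ x
  have h2 : φ (φ.symm x) = x := φ.apply_symm_apply x
  show (jacobian φ.symm x).transpose * ((jacobian φ (φ.symm x)).transpose * g (φ (φ.symm x)) *
    jacobian φ (φ.symm x)) * jacobian φ.symm x = g x
  calc _ = (jacobian φ (φ.symm x) * jacobian φ.symm x).transpose * g (φ (φ.symm x)) *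
        (jacobian φ (φ.symm x) * jacobian φ.symm x) := by
        rw [Matrix.transpose_mul]; simp only [Matrix.mul_assoc]
    _ = g x := by rw [h1, h2]; simp

theorem isLorentzian_eta : IsLorentzian eta :=
  ⟨fun _ _ => contDiff_const, fun _ => ⟨1, by simp, by simp [eta]⟩⟩

theorem contDiff_jacobian {f : Spacetime → Spacetime} (hf : ContDiff ℝ ∞ f) (μ ν : Fin 4) :
    ContDiff ℝ ∞ fun x => jacobian f x μ ν :=
  contDiff_pi.1 ((hf.fderiv_right (m := ∞) (by simp)).clm_apply contDiff_const) μ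

theorem contDiff_conj {P : Type*} [NormedAddCommGroup P] [NormedSpace ℝ P]
    {A B : P → Matrix (Fin 4) (Fin 4) ℝ} (hA : ∀ μ ν, ContDiff ℝ ∞ fun p => A p μ ν)
    (hB : ∀ μ ν, ContDiff ℝ ∞ fun p => B p μ ν) (μ ν : Fin 4) :
    ContDiff ℝ ∞ fun p => ((A p).transpose * B p * A p) μ ν := by
  simp only [Matrix.mul_apply, Matrix.transpose_apply]
  exact ContDiff.sum fun β _ => (ContDiff.sum fun α _ => (hA α μ).mul (hB α β)).mul (hA β ν)

theorem IsLorentzian.push {g : TensorField} (hg : IsLorentzian g) (φ : Diffeo) :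
    IsLorentzian (pushTensor φ g) := by
  have hs : ContDiff ℝ ∞ φ.symm := Diffeo.contDiff φ.symm
  refine ⟨fun μ ν => contDiff_conj (fun α β => contDiff_jacobian hs α β)
    (fun α β => (hg.smooth α β).comp hs) μ ν, fun x => ?_⟩
  obtain ⟨P, hP, hPg⟩ := hg.signature (φ.symm x)
  have h1 := jacobian_symm_mul_jacobian φ x
  refine ⟨jacobian φ (φ.symm x) * P, ?_, ?_⟩
  · rw [Matrix.det_mul]
    refine IsUnit.mul ?_ hP
    refine IsUnit.of_mul_eq_one (jacobian φ.symm x).det ?_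
    rw [← Matrix.det_mul, jacobian_mul_jacobian_symm, Matrix.det_one]
  · calc _ = P.transpose * (jacobian φ.symm x * jacobian φ (φ.symm x)).transpose * g (φ.symm x) *
          (jacobian φ.symm x * jacobian φ (φ.symm x)) * P := by
          rw [Matrix.transpose_mul, Matrix.transpose_mul, pushTensor]; simp only [Matrix.mul_assoc]
      _ = etaMatrix := by rw [h1]; simpa using hPg

/-- The Lie derivative `L_X η`. -/
noncomputable def lieEta (X : Spacetime → Spacetime) (x : Spacetime) : Matrix (Fin 4) (Fin 4) ℝ :=
  (jacobian X x).transpose * etaMatrix + etaMatrix * jacobian X x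

theorem lieEta_apply (X : Spacetime → Spacetime) (x : Spacetime) (μ ν : Fin 4) :
    lieEta X x μ ν = etaMatrix ν ν * jacobian X x ν μ + etaMatrix μ μ * jacobian X x μ ν := by
  simp [lieEta, etaMatrix, Matrix.mul_diagonal, Matrix.diagonal_mul, mul_comm]

namespace IsFlow

variable {X : Spacetime → Spacetime} {φ : ℝ → Diffeo}

theorem symm_eq (h : IsFlow X φ) (ε : ℝ) : (φ ε).symm = φ (-ε) :=
  Diffeomorph.ext (h.symm_apply ε)

theorem contDiff_jacobian (h : IsFlow X φ) (μ ν : Fin 4) :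
    ContDiff ℝ ∞ fun p : ℝ × Spacetime => jacobian (φ p.1) p.2 μ ν := by
  have h1 : ContDiff ℝ ∞ fun p : ℝ × Spacetime => fderiv ℝ (φ p.1) p.2 :=
    ContDiff.fderiv (n := ∞) (f := fun (p : ℝ × Spacetime) x => φ p.1 x)
      (h.smooth.comp (contDiff_fst.fst.prodMk contDiff_snd)) contDiff_snd (by simp)
  exact contDiff_pi.1 (h1.clm_apply contDiff_const) μ

/-- The parameter and space derivatives are interchanged through the Taylor expansion `φ_ε = id + ε
X + ε² H`: differentiating it in `x` leaves a remainder of order `ε²`, since `H` is smooth. -/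
theorem hasDerivAt_jacobian (h : IsFlow X φ) (x : Spacetime) (μ ν : Fin 4) :
    HasDerivAt (fun ε => jacobian (φ ε) x μ ν) (jacobian X x μ ν) 0 := by
  obtain ⟨hX, H, hH, e⟩ := exists_contDiff_taylor_two h.smooth (D := X) (fun x => by
    simpa [h.zero] using h.deriv 0 x)
  have hHx : ∀ ε, ContDiff ℝ ∞ fun x => H (ε, x) := fun ε =>
    hH.comp (contDiff_const.prodMk contDiff_id)
  let K : ℝ → ℝ := fun ε => fderiv ℝ (fun x => H (ε, x)) x (Pi.single ν 1) μ
  have hK : ContDiff ℝ ∞ K := by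
    have h1 : ContDiff ℝ ∞ fun ε : ℝ => fderiv ℝ (fun x => H (ε, x)) x :=
      ContDiff.fderiv (n := ∞) (f := fun (ε : ℝ) x => H (ε, x)) hH contDiff_const (by simp)
    exact contDiff_pi.1 (h1.clm_apply contDiff_const) μ
  have key : ∀ ε, jacobian (φ ε) x μ ν
      = (Pi.single ν 1 : Spacetime) μ + ε * jacobian X x μ ν + ε ^ 2 * K ε := by
    intro ε
    have h1 : (φ ε : Spacetime → Spacetime) = fun x => x + ε • X x + ε ^ 2 • H (ε, x) := by
      funext x
      simpa [h.zero] using e ε x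
    have h2 := (((hasFDerivAt_id x).add
      (((hX.differentiable (by simp)) x).hasFDerivAt.const_smul ε)).add
      ((((hHx ε).differentiable (by simp)) x).hasFDerivAt.const_smul (ε ^ 2)))
    have h3 : fderiv ℝ (φ ε) x = _ := (HasFDerivAt.congr_of_eventuallyEq h2
      (Eventually.of_forall fun z => congrFun h1 z)).fderiv
    simp [jacobian, h3, K]
  have h4 : HasDerivAt (fun ε : ℝ => (Pi.single ν 1 : Spacetime) μ + ε * jacobian X x μ ν
      + ε ^ 2 * K ε) (jacobian X x μ ν) 0 := by
    have h5 := ((hK.differentiable (by simp)) 0).hasDerivAt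
    have h6 := (((hasDerivAt_id (0 : ℝ)).mul_const (jacobian X x μ ν)).const_add
      ((Pi.single ν 1 : Spacetime) μ)).add ((hasDerivAt_pow 2 (0 : ℝ)).mul h5)
    refine h6.congr_deriv ?_
    simp
  exact h4.congr_of_eventuallyEq (Eventually.of_forall key)

theorem jacobian_zero (h : IsFlow X φ) (x : Spacetime) : jacobian (φ 0) x = 1 := by
  rw [← jacobian_id x]
  congr 1
  exact funext h.zero

theorem pushTensor_eq (h : IsFlow X φ) (g : TensorField) (ε : ℝ) (x : Spacetime) :
    pushTensor (φ ε) g x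
      = (jacobian (φ (-ε)) x).transpose * g (φ (-ε) x) * jacobian (φ (-ε)) x := by
  rw [pushTensor, h.symm_eq]

theorem smoothTensorFamily_push (h : IsFlow X φ) {g : ℝ → TensorField}
    (hg : SmoothTensorFamily g) : SmoothTensorFamily fun ε => pushTensor (φ ε) (g ε) := by
  intro μ ν
  simp only [h.pushTensor_eq]
  have h1 : ContDiff ℝ ∞ fun p : ℝ × Spacetime => ((-p.1, p.2) : ℝ × Spacetime) := by fun_prop
  refine contDiff_conj (A := fun p : ℝ × Spacetime => jacobian (φ (-p.1)) p.2)
    (B := fun p : ℝ × Spacetime => g p.1 (φ (-p.1) p.2))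
    (fun α β => (h.contDiff_jacobian α β).comp h1) (fun α β => ?_) μ ν
  exact (hg α β).comp (contDiff_fst.prodMk (h.smooth.comp h1))

theorem smoothTensorFamily_pull_eta (h : IsFlow X φ) :
    SmoothTensorFamily fun ε => pushTensor (φ ε).symm eta := by
  intro μ ν
  have h1 := h.smoothTensorFamily_push (g := fun _ => eta) (fun _ _ => contDiff_const) μ ν
  have h2 := h1.comp (contDiff_fst.neg.prodMk contDiff_snd :
    ContDiff ℝ ∞ fun p : ℝ × Spacetime => ((-p.1, p.2) : ℝ × Spacetime))
  simpa only [Function.comp_def, ← h.symm_eq] using h2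

/-- The first variation of the pushforward of a perturbed Minkowski metric along a flow. -/
theorem hasDerivAt_pushTensor (h : IsFlow X φ) {k : ℝ → TensorField}
    (hk : SmoothTensorFamily k) (hk0 : k 0 = 0) {D : Matrix (Fin 4) (Fin 4) ℝ} {x : Spacetime}
    (hD : ∀ μ ν, HasDerivAt (fun ε => k ε x μ ν) (D μ ν) 0) (μ ν : Fin 4) :
    HasDerivAt (fun ε => pushTensor (φ ε) (eta + k ε) x μ ν) (D μ ν - lieEta X x μ ν) 0 := by
  have hJ : ∀ α β, HasDerivAt (fun ε => jacobian (φ (-ε)) x α β) (-jacobian X x α β) 0 := by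
    intro α β
    have h1 := h.hasDerivAt_jacobian x α β
    rw [← neg_zero] at h1
    exact (h1.comp (0 : ℝ) (hasDerivAt_neg (0 : ℝ))).congr_deriv (by simp)
  have hB : ∀ α β, HasDerivAt (fun ε => (eta + k ε) (φ (-ε) x) α β) (D α β) 0 := by
    intro α β
    -- Since `k ε = ε H`, moving the base point along the flow affects the derivative only at second
    -- order; the background `η` is constant and does not see the motion at all.
    obtain ⟨H, hH, e⟩ := exists_contDiff_eq_smul (hk α β) (by simp [hk0])
    have hHd : ∀ u : ℝ → Spacetime, ContDiff ℝ ∞ u →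
        HasDerivAt (fun ε : ℝ => k ε (u ε) α β) (H (0, u 0)) 0 := by
      intro u hu
      have h1 : ContDiff ℝ ∞ fun ε : ℝ => H (ε, u ε) := hH.comp (contDiff_id.prodMk hu)
      have h2 := (hasDerivAt_id (0 : ℝ)).smul ((h1.differentiable (by simp)) 0).hasDerivAt
      refine (h2.congr_deriv (by simp)).congr_of_eventuallyEq (Eventually.of_forall fun ε => ?_)
      exact e ε (u ε)
    have h3 := hHd (fun ε => φ (-ε) x) (h.smooth.comp (contDiff_neg.prodMk contDiff_const))
    have h4 := (hD α β).unique (hHd (fun _ => x) contDiff_const)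
    simp only [neg_zero, h.zero] at h3
    rw [h4]
    exact h3.const_add (etaMatrix α β)
  simp only [h.pushTensor_eq, Matrix.mul_apply, Matrix.transpose_apply]
  have h5 := HasDerivAt.fun_sum (u := Finset.univ) fun β _ =>
    (HasDerivAt.fun_sum (u := Finset.univ) fun α _ => (hJ α μ).fun_mul (hB α β)).fun_mul (hJ β ν)
  refine h5.congr_deriv ?_
  have h6 : ∀ α β, (eta + k 0) (φ 0 x) α β = if α = β then etaMatrix α α else 0 := by
    intro α β
    simp [hk0, eta, etaMatrix, Matrix.diagonal_apply]
  simp only [neg_zero, h.jacobian_zero, h6, lieEta_apply, Matrix.one_apply]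
  simp [Finset.sum_add_distrib]
  ring

end IsFlow

end Tensors

/-! ### Pushforward of matter fields. -/

section Push

variable {F : Type*} [NormedAddCommGroup F] [NormedSpace ℝ F]

namespace NaturalBundle

variable (E : NaturalBundle F)

theorem push_eq_zero_iff (φ : Diffeo) (Ψ : Spacetime → F) (x : Spacetime) :
    E.push φ Ψ x = 0 ↔ Ψ (φ.symm x) = 0 := by
  simp [push, pushAlong]

theorem tsupport_push (φ : Diffeo) (Ψ : Spacetime → F) :
    tsupport (E.push φ Ψ) = φ '' tsupport Ψ := by
  have h1 : Function.support (E.push φ Ψ) = φ '' Function.support Ψ := by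
    ext x
    rw [Function.mem_support, Ne, push_eq_zero_iff]
    constructor
    · exact fun h => ⟨φ.symm x, h, φ.apply_symm_apply x⟩
    · rintro ⟨z, hz, rfl⟩
      rwa [φ.symm_apply_apply]
  rw [tsupport, h1, tsupport]
  exact (φ.toHomeomorph.image_closure _).symm

/-- The lift depends only on the germ, so near such a point it coincides with the lift of the
identity. -/
theorem push_eq_self_of_eventuallyEq {φ : Diffeo} {x : Spacetime} (h : ∀ᶠ z in 𝓝 x, φ z = z)
    (Ψ : Spacetime → F) : E.push φ Ψ x = Ψ x := by
  have h1 : φ.symm x = x := by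
    conv_lhs => rw [← h.self_of_nhds]
    exact φ.symm_apply_apply x
  have h2 := E.lift_local φ (Diffeomorph.refl _ _ _) x h
  simp only [push, pushAlong, h1, h2, E.lift_id]
  rfl

theorem push_flow_zero {X : Spacetime → Spacetime} {φ : ℝ → Diffeo} (h : IsFlow X φ)
    (Ψ : Spacetime → F) : E.push (φ 0) Ψ = Ψ :=
  funext fun _ => E.push_eq_self_of_eventuallyEq (Eventually.of_forall h.zero) Ψ

theorem contDiff_push_flow {X : Spacetime → Spacetime} {φ : ℝ → Diffeo} (h : IsFlow X φ)
    {Ψ : Spacetime → F} (hΨ : ContDiff ℝ ∞ Ψ) (t : ℝ) : ContDiff ℝ ∞ (E.push (φ t) Ψ) :=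
  (E.smooth_flow X φ h Ψ hΨ).comp (contDiff_const.prodMk contDiff_id)

end NaturalBundle

end Push

/-! ### Parameter expansions of integrals supported in a fixed compact set. -/

section Integrals

theorem integrableOn_of_eq_zero_off_compact {f : Spacetime → ℝ} (hf : Continuous f)
    {Z V : Set Spacetime} (hZ : IsCompact Z) (hV : MeasurableSet V)
    (h : ∀ x ∈ V, x ∉ Z → f x = 0) : IntegrableOn f V :=
  (hf.continuousOn.integrableOn_compact hZ).of_forall_sdiff_eq_zero hV fun x hx => h x hx.1 hx.2

/-- For small `ε` the integrand lives on `V ∩ Z`, of finite measure, and `K` is bounded on `[-1, 1]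
× Z`. -/
theorem isBigO_setIntegral {f : ℝ → Spacetime → ℝ} {K : ℝ × Spacetime → ℝ} (hK : Continuous K)
    {Z V : Set Spacetime} (hZ : IsCompact Z) (hV : MeasurableSet V) {k : ℕ}
    (hz : ∀ᶠ ε in 𝓝 (0 : ℝ), ∀ x ∈ V, x ∉ Z → f ε x = 0)
    (he : ∀ ε x, f ε x = ε ^ k * K (ε, x)) :
    (fun ε => ∫ x in V, f ε x) =O[𝓝 0] fun ε : ℝ => ε ^ k := by
  obtain ⟨C, hC⟩ := (isCompact_Icc.prod hZ : IsCompact (Icc (-1 : ℝ) 1 ×ˢ Z)).exists_bound_of_continuousOn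
    hK.continuousOn
  refine IsBigO.of_bound (C * volume.real (V ∩ Z)) ?_
  filter_upwards [hz, Icc_mem_nhds (show (-1 : ℝ) < 0 by norm_num) zero_lt_one] with ε hε hε1
  have hVZ : ∫ x in V, f ε x = ∫ x in V ∩ Z, f ε x :=
    setIntegral_eq_of_subset_of_forall_sdiff_eq_zero hV inter_subset_left
      fun x hx => hε x hx.1 fun hxZ => hx.2 ⟨hx.1, hxZ⟩
  rw [hVZ]
  have hfin : volume (V ∩ Z) < ⊤ := (measure_mono inter_subset_right).trans_lt hZ.measure_lt_top
  have := norm_setIntegral_le_of_norm_le_const (f := f ε) (C := C * ‖ε ^ k‖) hfin (fun x hx => by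
    rw [he, norm_mul, mul_comm]
    exact mul_le_mul_of_nonneg_right (hC (ε, x) ⟨hε1, hx.2⟩) (norm_nonneg _))
  calc _ ≤ _ := this
    _ = _ := by ring

/-- First-order expansion of an integral depending on a parameter. -/
theorem isBigO_setIntegral_taylor {G : ℝ × Spacetime → ℝ} (hG : ContDiff ℝ ∞ G)
    (hG0 : ∀ x, G (0, x) = 0) {D : Spacetime → ℝ}
    (hD : ∀ x, HasDerivAt (fun ε => G (ε, x)) (D x) 0) {Z V : Set Spacetime} (hZ : IsCompact Z)
    (hV : MeasurableSet V) (hz : ∀ ε, ∀ x ∈ V, x ∉ Z → G (ε, x) = 0) :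
    (fun ε => (∫ x in V, G (ε, x)) - ε * ∫ x in V, D x) =O[𝓝 0] fun ε : ℝ => ε ^ 2 := by
  obtain ⟨hDs, H, hH, e⟩ := exists_contDiff_taylor_two hG hD
  have hDz : ∀ x ∈ V, x ∉ Z → D x = 0 := fun x hx hxZ => by
    have h1 : (fun ε => G (ε, x)) = fun _ => 0 := funext fun ε => hz ε x hx hxZ
    have h2 := hD x
    rw [h1] at h2
    exact h2.unique (hasDerivAt_const _ _)
  have hGi : ∀ ε, IntegrableOn (fun x => G (ε, x)) V := fun ε =>
    integrableOn_of_eq_zero_off_compact (hG.continuous.comp (by fun_prop)) hZ hV (hz ε)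
  have hDi : IntegrableOn D V := integrableOn_of_eq_zero_off_compact hDs.continuous hZ hV hDz
  have key := isBigO_setIntegral (f := fun ε x => G (ε, x) - ε * D x) (k := 2) hH.continuous hZ hV
    (Eventually.of_forall fun ε x hx hxZ => by simp [hz ε x hx hxZ, hDz x hx hxZ])
    (fun ε x => by rw [e ε x, hG0]; simp)
  refine key.congr_left fun ε => ?_
  rw [integral_sub (hGi ε) (hDi.const_mul ε), integral_const_mul]

theorem hasDerivAt_of_isBigO_sq {f : ℝ → ℝ} {A : ℝ}
    (h : (fun ε : ℝ => f ε - f 0 - ε * A) =O[𝓝 0] fun ε : ℝ => ε ^ 2) : HasDerivAt f A 0 := by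
  rw [hasDerivAt_iff_isLittleO]
  have h1 : (fun ε : ℝ => ε ^ 2) =o[𝓝 0] fun ε : ℝ => ε := by
    simpa using isLittleO_pow_id (𝕜 := ℝ) one_lt_two
  simpa using h.trans_isLittleO h1

end Integrals

/-! ### Contractions. -/

section Contract

theorem contract_zero_left (B : Matrix (Fin 4) (Fin 4) ℝ) : contract 0 B = 0 := by
  simp [contract]

theorem contract_zero_right (A : Matrix (Fin 4) (Fin 4) ℝ) : contract A 0 = 0 := by
  simp [contract]

theorem contDiff_contract {P : Type*} [NormedAddCommGroup P] [NormedSpace ℝ P]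
    {A B : P → Matrix (Fin 4) (Fin 4) ℝ} (hA : ∀ μ ν, ContDiff ℝ ∞ fun p => A p μ ν)
    (hB : ∀ μ ν, ContDiff ℝ ∞ fun p => B p μ ν) : ContDiff ℝ ∞ fun p => contract (A p) (B p) :=
  ContDiff.sum fun μ _ => ContDiff.sum fun ν _ => (hA μ ν).mul (hB μ ν)

theorem hasDerivAt_contract {A : Matrix (Fin 4) (Fin 4) ℝ} {B : ℝ → Matrix (Fin 4) (Fin 4) ℝ}
    {D : Matrix (Fin 4) (Fin 4) ℝ} {t : ℝ}
    (hB : ∀ μ ν, HasDerivAt (fun ε => B ε μ ν) (D μ ν) t) :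
    HasDerivAt (fun ε => contract A (B ε)) (contract A D) t :=
  HasDerivAt.fun_sum fun μ _ => HasDerivAt.fun_sum fun ν _ => (hB μ ν).const_mul (A μ ν)

end Contract

/-! ### First variation under diffeomorphisms; conservation of energy-momentum. -/

section Variation

variable {F : Type*} [NormedAddCommGroup F] [NormedSpace ℝ F] {c : ℝ} {E : NaturalBundle F}
  {S : Action F} {T : TensorField → (Spacetime → F) → TensorField} {Ψ : Spacetime → F}

namespace IsEnergyMomentumTensor

theorem contDiff_family (hT : IsEnergyMomentumTensor c S T) {ψ : ℝ → Spacetime → F}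
    (hψ : SmoothFieldFamily ψ) (μ ν : Fin 4) :
    ContDiff ℝ ∞ fun p : ℝ × Spacetime => T eta (ψ p.1) p.2 μ ν :=
  hT.smooth (fun _ => eta) ψ (fun _ _ => contDiff_const) (fun _ => isLorentzian_eta) hψ μ ν

theorem contDiff (hT : IsEnergyMomentumTensor c S T) (hΨ : ContDiff ℝ ∞ Ψ) (μ ν : Fin 4) :
    ContDiff ℝ ∞ fun x => T eta Ψ x μ ν :=
  (hT.contDiff_family (ψ := fun _ => Ψ) (hΨ.comp contDiff_snd) μ ν).comp
    ((contDiff_const (c := (0 : ℝ))).prodMk contDiff_id)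

theorem eq_zero (hT : IsEnergyMomentumTensor c S T) (hΨ : ContDiff ℝ ∞ Ψ) {x : Spacetime}
    (hx : x ∉ tsupport Ψ) : T eta Ψ x = 0 :=
  image_eq_zero_of_notMem_tsupport fun h => hx (hT.locality eta Ψ isLorentzian_eta hΨ h)

theorem eq_zero_off (hT : IsEnergyMomentumTensor c S T) (hΨ : ContDiff ℝ ∞ Ψ) {V : Set Spacetime}
    {x : Spacetime} (hxV : x ∈ V) (hx : x ∉ tsupport Ψ ∩ closure V) : T eta Ψ x = 0 :=
  hT.eq_zero hΨ fun h => hx ⟨h, subset_closure hxV⟩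

/-- First-order expansion of the action around the Minkowski metric. -/
theorem isBigO_expansion (hT : IsEnergyMomentumTensor c S T) (hΨ : ContDiff ℝ ∞ Ψ)
    {V : Set Spacetime} (hV : Admissible Ψ V) {γ : ℝ → TensorField} (hγ : SmoothTensorFamily γ)
    (hγL : ∀ᶠ ε in 𝓝 (0 : ℝ), IsLorentzian (γ ε)) (hγ0 : γ 0 = eta)
    {D : Spacetime → Matrix (Fin 4) (Fin 4) ℝ}
    (hD : ∀ x μ ν, HasDerivAt (fun ε => γ ε x μ ν) (D x μ ν) 0) :
    (fun ε : ℝ => S (γ ε) Ψ V - S eta Ψ V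
      - ε * (1 / (2 * c) * ∫ x in V, contract (T eta Ψ x) (D x))) =O[𝓝 0] fun ε : ℝ => ε ^ 2 := by
  have h1 := hT.expansion γ Ψ V hγ hγL hΨ hV
  have hdet : ∀ x : Spacetime, Real.sqrt |(eta x).det| = 1 := fun x => by
    simp [eta, etaMatrix, Matrix.det_diagonal, Fin.prod_univ_succ]
  simp only [hγ0, hdet, one_mul] at h1
  have hs : ∀ μ ν, ContDiff ℝ ∞ fun p : ℝ × Spacetime => (γ p.1 p.2 - eta p.2) μ ν := fun μ ν =>
    (hγ μ ν).sub contDiff_const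
  have h2 := isBigO_setIntegral_taylor
    (G := fun p => contract (T eta Ψ p.2) (γ p.1 p.2 - eta p.2)) (V := V)
    (contDiff_contract (fun μ ν => (hT.contDiff hΨ μ ν).comp contDiff_snd) hs)
    (fun x => by simp [hγ0, contract_zero_right]) (D := fun x => contract (T eta Ψ x) (D x))
    (fun x => hasDerivAt_contract (A := T eta Ψ x) (B := fun ε => γ ε x - eta x) fun μ ν =>
      (hD x μ ν).sub_const _) hV.2 hV.1.measurableSet
    (fun ε x hx hxZ => by rw [hT.eq_zero_off hΨ hx hxZ, contract_zero_left])
  refine (h1.add (h2.const_mul_left (1 / (2 * c)))).congr_left fun ε => ?_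
  ring

/-- First variation of the action under an active diffeomorphism of the matter fields. -/
theorem isBigO_push (hT : IsEnergyMomentumTensor c S T) (hS : DiffeoInvariant E S)
    (hΨ : ContDiff ℝ ∞ Ψ) {V : Set Spacetime} (hV : Admissible Ψ V)
    {X : Spacetime → Spacetime} {φ : ℝ → Diffeo} (hφ : IsFlow X φ) (hφV : ∀ ε, φ ε '' V = V) :
    (fun ε : ℝ => S eta (E.push (φ ε) Ψ) V - S eta Ψ V
      - ε * (1 / (2 * c) * ∫ x in V, contract (T eta Ψ x) (lieEta X x)))
        =O[𝓝 0] fun ε : ℝ => ε ^ 2 := by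
  have h0 : pushTensor (φ 0).symm eta = eta := by
    funext x
    rw [hφ.symm_eq, hφ.pushTensor_eq]
    simp [hφ.jacobian_zero, eta]
  -- The metric is moved by the inverse flow, so the first variation of the metric is `+L_X η`: the
  -- derivative along the forward flow is composed with `ε ↦ -ε`.
  have h1 := hT.isBigO_expansion hΨ hV (γ := fun ε => pushTensor (φ ε).symm eta)
    hφ.smoothTensorFamily_pull_eta
    (Eventually.of_forall fun ε => isLorentzian_eta.push _) h0 (D := lieEta X) (fun x μ ν => by
      have h2 := hφ.hasDerivAt_pushTensor (k := fun _ => 0) (fun _ _ => contDiff_const) rfl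
        (D := 0) (x := x) (fun μ ν => hasDerivAt_const _ _) μ ν
      have h3 : HasDerivAt (fun ε => pushTensor (φ ε) (eta + 0) x μ ν) (0 - lieEta X x μ ν)
          (-(0 : ℝ)) := by rw [neg_zero]; exact h2
      refine ((h3.comp (0 : ℝ) (hasDerivAt_neg (0 : ℝ))).congr_deriv (by simp)).congr_of_eventuallyEq
        (Eventually.of_forall fun ε => ?_)
      simp [hφ.symm_eq])
  refine h1.congr_left fun ε => ?_
  have h3 := hS (φ ε) (pushTensor (φ ε).symm eta) Ψ V (isLorentzian_eta.push _) hΨ hV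
  rw [pushTensor_pushTensor_symm, hφV] at h3
  rw [h3]

theorem hasDerivAt_push (hT : IsEnergyMomentumTensor c S T) (hS : DiffeoInvariant E S)
    (hΨ : ContDiff ℝ ∞ Ψ) {V : Set Spacetime} (hV : Admissible Ψ V)
    {X : Spacetime → Spacetime} {φ : ℝ → Diffeo} (hφ : IsFlow X φ) (hφV : ∀ ε, φ ε '' V = V) :
    HasDerivAt (fun ε => S eta (E.push (φ ε) Ψ) V)
      (1 / (2 * c) * ∫ x in V, contract (T eta Ψ x) (lieEta X x)) 0 := by
  refine hasDerivAt_of_isBigO_sq ((hT.isBigO_push hS hΨ hV hφ hφV).congr_left fun ε => ?_)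
  rw [E.push_flow_zero hφ]

end IsEnergyMomentumTensor

/-- Off `K` the flow is the identity near each point, so by germ locality of the lift the
pushforward is a variation supported in `K`, to which the field equations apply. -/
theorem SolvesFieldEquations.hasDerivAt_push (hΨs : SolvesFieldEquations S Ψ)
    (hΨ : ContDiff ℝ ∞ Ψ) {V K : Set Spacetime} (hV : Admissible Ψ V) (hK : IsCompact K)
    (hKV : K ⊆ V) {X : Spacetime → Spacetime} {φ : ℝ → Diffeo} (hX : ∀ x ∉ K, X x = 0)
    (hφ : IsFlow X φ) : HasDerivAt (fun ε => S eta (E.push (φ ε) Ψ) V) 0 0 := by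
  refine hΨs V hV (fun ε => E.push (φ ε) Ψ) (E.smooth_flow X φ hφ Ψ hΨ) (E.push_flow_zero hφ Ψ)
    ⟨K, hK, hKV, fun ε x hx => E.push_eq_self_of_eventuallyEq ?_ Ψ⟩
  filter_upwards [hK.isClosed.isOpen_compl.mem_nhds hx] with z hz using hφ.eq_self (hX z hz) ε

/-- On solutions, the energy-momentum tensor is orthogonal to the trivial metric perturbations
with compact support. -/
theorem integral_contract_lieEta_eq_zero (hc : 0 < c) (hT : IsEnergyMomentumTensor c S T)
    (hS : DiffeoInvariant E S) (hΨ : ContDiff ℝ ∞ Ψ) (hΨs : SolvesFieldEquations S Ψ)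
    {V K : Set Spacetime} (hV : Admissible Ψ V) (hK : IsCompact K)
    (hKV : K ⊆ V) {X : Spacetime → Spacetime} {φ : ℝ → Diffeo} (hX : ∀ x ∉ K, X x = 0)
    (hφ : IsFlow X φ) : ∫ x in V, contract (T eta Ψ x) (lieEta X x) = 0 := by
  -- Two values of the same derivative: one from invariance of the action, one from the field
  -- equations.
  have h1 := (hT.hasDerivAt_push hS hΨ hV hφ (hφ.image_eq hKV hX)).unique
    (hΨs.hasDerivAt_push (E := E) hΨ hV hK hKV hX hφ)
  exact (mul_eq_zero.1 h1).resolve_left (by positivity)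

/-- Equality of the linearised actions for fields related by an active diffeomorphism. -/
theorem linearised_actions (hc : 0 < c) (hT : IsEnergyMomentumTensor c S T)
    (hS : DiffeoInvariant E S) (hΨ : ContDiff ℝ ∞ Ψ) (hΨs : SolvesFieldEquations S Ψ)
    {V K : Set Spacetime} (hV : Admissible Ψ V) (hK : IsCompact K)
    (hKV : K ⊆ V) {X : Spacetime → Spacetime} {φ : ℝ → Diffeo} (hX : ∀ x ∉ K, X x = 0)
    (hφ : IsFlow X φ) :
    ((fun ε : ℝ => S eta (E.push (φ ε) Ψ) V - S eta Ψ V) =O[𝓝 0] fun ε : ℝ => ε ^ 2) ∧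
      ∀ h : ℝ → TensorField, SmoothTensorFamily h → h 0 = 0 →
        (fun ε : ℝ => ∫ x in V, contract (T eta Ψ x)
            (h ε x - (pushTensor (φ ε) (eta + h ε) x - eta x)))
          =O[𝓝 0] fun ε : ℝ => ε ^ 2 := by
  have h0 := integral_contract_lieEta_eq_zero hc hT hS hΨ hΨs hV hK hKV hX hφ
  refine ⟨?_, fun h hh hh0 => ?_⟩
  · refine (hT.isBigO_push hS hΨ hV hφ (hφ.image_eq hKV hX)).congr_left fun ε => ?_
    rw [h0]; ring
  have hp : SmoothTensorFamily fun ε => pushTensor (φ ε) (eta + h ε) :=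
    hφ.smoothTensorFamily_push fun μ ν => contDiff_const.add (hh μ ν)
  have hd : ∀ x μ ν, HasDerivAt (fun ε => h ε x μ ν) (deriv (fun ε => h ε x μ ν) 0) 0 :=
    fun x μ ν => ((((hh μ ν).comp (contDiff_id.prodMk contDiff_const)).differentiable
      (by simp)) 0).hasDerivAt
  -- The first variation of the pushed metric is `h' - L_X η`, so `h` cancels in the difference and
  -- only `L_X η` is left.
  have h1 := isBigO_setIntegral_taylor
    (G := fun p => contract (T eta Ψ p.2)
      (h p.1 p.2 - (pushTensor (φ p.1) (eta + h p.1) p.2 - eta p.2))) (V := V)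
    (contDiff_contract (fun μ ν => (hT.contDiff hΨ μ ν).comp contDiff_snd)
      (fun μ ν => (hh μ ν).sub ((hp μ ν).sub contDiff_const)))
    (fun x => by simp [hh0, hφ.pushTensor_eq, hφ.jacobian_zero, eta, contract_zero_right])
    (D := fun x => contract (T eta Ψ x) (lieEta X x))
    (fun x => hasDerivAt_contract (A := T eta Ψ x)
        (B := fun ε => h ε x - (pushTensor (φ ε) (eta + h ε) x - eta x)) fun μ ν => by
      have h2 := hφ.hasDerivAt_pushTensor hh hh0
        (D := fun μ ν => deriv (fun ε => h ε x μ ν) 0) (x := x) (hd x) μ ν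
      exact ((hd x μ ν).fun_sub (h2.sub_const (eta x μ ν))).congr_deriv (by ring))
    hV.2 hV.1.measurableSet
    (fun ε x hx hxZ => by rw [hT.eq_zero_off hΨ hx hxZ, contract_zero_left])
  refine h1.congr_left fun ε => ?_
  rw [h0]; ring

/-- Conservation of energy-momentum. -/
theorem divergence_eq_zero (hc : 0 < c) (hT : IsEnergyMomentumTensor c S T)
    (hS : DiffeoInvariant E S) (hΨ : ContDiff ℝ ∞ Ψ) (hΨs : SolvesFieldEquations S Ψ)
    (ν : Fin 4) (x₀ : Spacetime) :
    ∑ μ, fderiv ℝ (fun z => T eta Ψ z μ ν) x₀ (Pi.single μ 1) = 0 := by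
  have hTs := hT.contDiff hΨ
  have hTd : ∀ μ ν, Differentiable ℝ fun z => T eta Ψ z μ ν := fun μ ν =>
    (hTs μ ν).differentiable (by simp)
  have hTc : ∀ μ, Continuous fun x => fderiv ℝ (fun z => T eta Ψ z μ ν) x (Pi.single μ 1) :=
    fun μ => (((hTs μ ν).fderiv_right (m := ∞) (by simp)).clm_apply contDiff_const).continuous
  let d : Spacetime → ℝ := fun x => ∑ μ, fderiv ℝ (fun z => T eta Ψ z μ ν) x (Pi.single μ 1)
  have hdc : Continuous d := continuous_finsetSum _ fun μ _ => hTc μ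
  -- The divergence is orthogonal to every bump `ψ` for which `ψ e_ν` has a complete flow.
  -- Nonnegative bumps of this kind exist around every point, which suffices since the divergence is
  -- continuous.
  have weak : ∀ ψ : Spacetime → ℝ, ContDiff ℝ ∞ ψ → ∀ K : Set Spacetime, IsCompact K →
      (∀ x ∉ K, ψ x = 0) → ∀ φ : ℝ → Diffeo, IsFlow (fun x => Pi.single ν (ψ x)) φ →
      ∫ x, d x * ψ x = 0 := by
    intro ψ hψ K hK hψK φ hφ
    obtain ⟨R, hR⟩ := hK.isBounded.subset_ball 0
    have hψc : HasCompactSupport ψ := HasCompactSupport.intro hK hψK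
    have hV : Admissible Ψ (Metric.ball 0 R) := ⟨Metric.isOpen_ball,
      (isCompact_closedBall (0 : Spacetime) R).of_isClosed_subset
        ((isClosed_tsupport _).inter isClosed_closure)
        (inter_subset_right.trans Metric.closure_ball_subset_closedBall)⟩
    have h1 := integral_contract_lieEta_eq_zero hc hT hS hΨ hΨs hV hK hR
      (fun x hx => by simp [hψK x hx]) hφ
    have hψd : ∀ x, DifferentiableAt ℝ ψ x := fun x => (hψ.differentiable (by simp)) x
    have hjac : ∀ x α β, jacobian (fun x => Pi.single ν (ψ x)) x α β
        = if α = ν then fderiv ℝ ψ x (Pi.single β 1) else 0 := by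
      intro x α β
      have h2 : HasFDerivAt (fun x => (Pi.single ν (ψ x) : Spacetime))
          ((ContinuousLinearMap.single ℝ (fun _ : Fin 4 => ℝ) ν).comp (fderiv ℝ ψ x)) x :=
        (ContinuousLinearMap.single ℝ (fun _ : Fin 4 => ℝ) ν).hasFDerivAt.comp x
          (hψd x).hasFDerivAt
      rw [jacobian, h2.fderiv]
      simp [Pi.single_apply]
    have hcontr : ∀ x, contract (T eta Ψ x) (lieEta (fun x => Pi.single ν (ψ x)) x)
        = 2 * etaMatrix ν ν * ∑ μ, T eta Ψ x μ ν * fderiv ℝ ψ x (Pi.single μ 1) := by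
      intro x
      have hsymm : ∀ μ, T eta Ψ x ν μ = T eta Ψ x μ ν := fun μ =>
        (hT.symm eta Ψ isLorentzian_eta hΨ x).apply μ ν
      simp only [contract, lieEta_apply, hjac, mul_add, Finset.sum_add_distrib, mul_ite, mul_zero,
        Finset.sum_ite_eq', Finset.mem_univ, if_true]
      rw [Finset.sum_comm (f := fun μ ρ => if μ = ν then _ else _)]
      simp only [Finset.sum_ite_eq', Finset.mem_univ, if_true, hsymm, Finset.mul_sum]
      rw [← Finset.sum_add_distrib]
      exact Finset.sum_congr rfl fun μ _ => by ring
    have hfc : ∀ μ, HasCompactSupport fun x => fderiv ℝ ψ x (Pi.single μ 1) := fun μ =>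
      hψc.fderiv_apply ℝ _
    have hfcont : ∀ μ : Fin 4, Continuous fun x => fderiv ℝ ψ x (Pi.single μ 1) := fun μ =>
      ((hψ.fderiv_right (m := ∞) (by simp)).clm_apply contDiff_const).continuous
    simp only [hcontr] at h1
    rw [integral_const_mul, setIntegral_eq_integral_of_forall_compl_eq_zero (fun x hx => by
      refine Finset.sum_eq_zero fun μ _ => ?_
      have h3 : x ∉ tsupport ψ := fun h => hx (hR (closure_minimal
        (fun z (hz : ψ z ≠ 0) => by_contra fun hzK => hz (hψK z hzK)) hK.isClosed h))
      rw [fderiv_of_notMem_tsupport (𝕜 := ℝ) h3]; simp)] at h1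
    have h4 : ∫ x, ∑ μ, T eta Ψ x μ ν * fderiv ℝ ψ x (Pi.single μ 1) = 0 := by
      refine (mul_eq_zero.1 h1).resolve_left (mul_ne_zero two_ne_zero ?_)
      rw [etaMatrix, Matrix.diagonal_apply_eq]
      refine Fin.cases ?_ (fun a => ?_) ν <;> simp
    have i1 : ∀ μ, Integrable fun x => T eta Ψ x μ ν * fderiv ℝ ψ x (Pi.single μ 1) := fun μ =>
      ((hTs μ ν).continuous.mul (hfcont μ)).integrable_of_hasCompactSupport (hfc μ).mul_left
    have i2 : ∀ μ, Integrable fun x =>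
        fderiv ℝ (fun z => T eta Ψ z μ ν) x (Pi.single μ 1) * ψ x := fun μ =>
      ((hTc μ).mul hψ.continuous).integrable_of_hasCompactSupport hψc.mul_left
    have i3 : ∀ μ, Integrable fun x => T eta Ψ x μ ν * ψ x := fun μ =>
      ((hTs μ ν).continuous.mul hψ.continuous).integrable_of_hasCompactSupport hψc.mul_left
    rw [integral_finsetSum _ fun μ _ => i1 μ] at h4
    simp only [d, Finset.sum_mul]
    rw [integral_finsetSum _ fun μ _ => i2 μ, ← neg_eq_zero, ← Finset.sum_neg_distrib, ← h4]
    exact Finset.sum_congr rfl fun μ _ =>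
      (integral_mul_fderiv_eq_neg_fderiv_mul_of_integrable (i2 μ) (i1 μ) (i3 μ)
        (fun x _ => hTd μ ν x) (fun x _ => hψd x)).symm
  by_contra hne
  have hne' : d x₀ ≠ 0 := hne
  have hpos : ∀ᶠ x in 𝓝 x₀, 0 < d x * d x₀ :=
    (hdc.mul continuous_const).continuousAt.eventually
      (lt_mem_nhds (mul_self_pos.2 hne'))
  -- If `d x₀ ≠ 0`, then `d` keeps its sign on a small ball, and a bump supported there makes the
  -- integral of `d ψ d(x₀)` strictly positive.
  obtain ⟨δ, hδ, hball⟩ := Metric.nhds_basis_closedBall.eventually_iff.1 hpos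
  obtain ⟨ψ, φ, hψ, hψ0, hψx, hψz, hφ⟩ := exists_bump_isFlow x₀ ν hδ
  have h1 := weak ψ hψ _ (isCompact_closedBall _ _) hψz φ hφ
  have h2 : 0 < ∫ x, d x * ψ x * d x₀ := by
    refine Continuous.integral_pos_of_hasCompactSupport_nonneg_nonzero (x := x₀)
      ((hdc.mul hψ.continuous).mul continuous_const)
      ((HasCompactSupport.intro (isCompact_closedBall _ _) hψz).mul_left.mul_right)
      (fun x => ?_) (mul_ne_zero (mul_ne_zero hne' hψx.ne') hne')
    by_cases hx : x ∈ Metric.closedBall x₀ δ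
    · have := mul_nonneg (hball hx).le (hψ0 x)
      simp only [Pi.zero_apply]
      linarith
    · simp [hψz x hx]
  rw [integral_mul_const, h1, zero_mul] at h2
  exact lt_irrefl _ h2

end Variation

/-! ### Slabs between time slices. -/

section Slab

theorem isOpen_slab (s₀ s₁ : ℝ) : IsOpen (slab s₀ s₁) :=
  (isOpen_lt continuous_const (continuous_apply 0)).inter
    (isOpen_lt (continuous_apply 0) continuous_const)

theorem isClosed_closedSlab (s₀ s₁ : ℝ) : IsClosed {x : Spacetime | s₀ ≤ x 0 ∧ x 0 ≤ s₁} :=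
  (isClosed_le continuous_const (continuous_apply 0)).inter
    (isClosed_le (continuous_apply 0) continuous_const)

theorem closure_slab_subset (s₀ s₁ : ℝ) :
    closure (slab s₀ s₁) ⊆ {x : Spacetime | s₀ ≤ x 0 ∧ x 0 ≤ s₁} :=
  closure_minimal (fun _ hx => ⟨hx.1.le, hx.2.le⟩) (isClosed_closedSlab s₀ s₁)

variable {F : Type*} [NormedAddCommGroup F] {Ψ : Spacetime → F}

theorem SpatiallyCompact.isCompact_inter (h : SpatiallyCompact Ψ) (s₀ s₁ : ℝ) :
    IsCompact (tsupport Ψ ∩ {x : Spacetime | s₀ ≤ x 0 ∧ x 0 ≤ s₁}) := by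
  obtain ⟨K, hK, hKΨ⟩ := h
  refine ((isCompact_Icc (a := s₀) (b := s₁)).prod hK |>.image
    (contDiff_event (n := 0)).continuous).of_isClosed_subset
    ((isClosed_tsupport _).inter (isClosed_closedSlab _ _)) fun x hx => ?_
  exact ⟨(x 0, spatial x), ⟨hx.2, hKΨ x hx.1⟩, event_spatial x⟩

theorem SpatiallyCompact.admissible_slab (h : SpatiallyCompact Ψ) (s₀ s₁ : ℝ) :
    Admissible Ψ (slab s₀ s₁) :=
  ⟨isOpen_slab _ _, (h.isCompact_inter s₀ s₁).of_isClosed_subset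
    ((isClosed_tsupport _).inter isClosed_closure)
    (inter_subset_inter_right _ (closure_slab_subset _ _))⟩

theorem IsFlow.image_slab {X : Spacetime → Spacetime} {φ : ℝ → Diffeo} (h : IsFlow X φ)
    (h0 : ∀ t x, φ t x 0 = x 0) (s₀ s₁ t : ℝ) : φ t '' slab s₀ s₁ = slab s₀ s₁ := by
  refine Subset.antisymm (image_subset_iff.2 fun x hx => ?_) fun x hx => ⟨φ (-t) x, ?_, ?_⟩
  · simpa [slab, h0] using hx
  · simpa [slab, h0] using hx
  · rw [← h.add]; simp [h.zero]

/-- The bounding hyperplanes are null sets; this joins the open slab of the action to the closed one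
of the virial integral. -/
theorem slab_ae_eq_closedSlab (s₀ s₁ : ℝ) :
    slab s₀ s₁ =ᵐ[volume] {x : Spacetime | s₀ ≤ x 0 ∧ x 0 ≤ s₁} := by
  have h : ∀ a : ℝ, ∀ᵐ x : Spacetime, x 0 ≠ a := fun a => by
    rw [volume_pi]
    exact Measure.ae_eval_ne (μ := fun _ : Fin 4 => (volume : Measure ℝ)) 0 a
  filter_upwards [h s₀, h s₁] with x h₀ h₁
  apply propext
  exact ⟨fun hx => ⟨hx.1.le, hx.2.le⟩, fun hx => ⟨lt_of_le_of_ne hx.1 (Ne.symm h₀),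
    lt_of_le_of_ne hx.2 h₁⟩⟩

end Slab

/-! ### Rescaling fields and the Newtonian metric. -/

section Rescaling

/-- The Jacobian matrix of an affine map that is diagonal up to a translation. -/
theorem jacobian_event_affine (α β : ℝ) (y z : Space) (x : Spacetime) :
    jacobian (fun x => event (α * x 0) (z + β • (spatial x - y))) x
      = Matrix.diagonal (Fin.cons α fun _ => β) := by
  have h : ∀ μ, HasFDerivAt (fun x : Spacetime => event (α * x 0) (z + β • (spatial x - y)) μ)
      ((Fin.cons α fun _ => β : Fin 4 → ℝ) μ •
        ContinuousLinearMap.proj (R := ℝ) (φ := fun _ : Fin 4 => ℝ) μ) x := by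
    intro μ
    refine Fin.cases ?_ (fun a => ?_) μ
    · exact (hasFDerivAt_apply (0 : Fin 4) x).const_mul α
    · exact (((hasFDerivAt_apply a.succ x).sub_const (y a)).const_mul β).const_add (z a)
  ext μ ν
  rw [jacobian, (hasFDerivAt_pi.2 h).fderiv]
  simp only [ContinuousLinearMap.coe_pi', smul_apply,
    ContinuousLinearMap.proj_apply, smul_eq_mul, Matrix.diagonal_apply, Pi.single_apply]
  by_cases hμ : μ = ν <;> simp [hμ]

theorem jacobian_congr {f g : Spacetime → Spacetime} {x : Spacetime} (h : f =ᶠ[𝓝 x] g) :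
    jacobian f x = jacobian g x := by
  funext μ ν
  rw [jacobian, jacobian, h.fderiv_eq]

theorem contract_diagonal_cons (A : Matrix (Fin 4) (Fin 4) ℝ) (α β : ℝ) :
    contract A (Matrix.diagonal (Fin.cons α fun _ => β)) = α * A 0 0 + β * spatialTrace A := by
  have h : contract A (Matrix.diagonal (Fin.cons α fun _ => β))
      = ∑ μ, A μ μ * (Fin.cons α fun _ => β : Fin 4 → ℝ) μ := by
    simp [contract, Matrix.diagonal_apply]
  rw [h, Fin.sum_univ_succ, spatialTrace, Finset.mul_sum]
  simp [mul_comm]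

/-- Near `x` the field is affine with Jacobian `diag(0, -1, -1, -1)`, so `L_X η = diag(0, -2, -2,
-2)`. -/
theorem contract_lieEta_rescalingField {ξ : Space → ℝ} {y : Space} {x : Spacetime}
    (hξ : ∀ᶠ z in 𝓝 (spatial x), ξ z = 1) (A : Matrix (Fin 4) (Fin 4) ℝ) :
    contract A (lieEta (rescalingField ξ y) x) = -2 * spatialTrace A := by
  have h1 : rescalingField ξ y =ᶠ[𝓝 x]
      fun x => event (0 * x 0) (0 + (-1 : ℝ) • (spatial x - y)) := by
    filter_upwards [continuous_spatial.continuousAt.eventually hξ] with z hz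
    simp [rescalingField, hz]
  have h2 : lieEta (rescalingField ξ y) x = Matrix.diagonal (Fin.cons 0 fun _ => -2) := by
    rw [lieEta, jacobian_congr h1, jacobian_event_affine, etaMatrix, Matrix.diagonal_transpose,
      Matrix.diagonal_mul_diagonal, Matrix.diagonal_mul_diagonal, Matrix.diagonal_add]
    congr 1
    funext μ
    refine Fin.cases ?_ (fun a => ?_) μ
    · simp
    · norm_num
  rw [h2, contract_diagonal_cons]
  ring

theorem contract_smul_one (A : Matrix (Fin 4) (Fin 4) ℝ) (a : ℝ) :
    contract A (a • 1) = a * (A 0 0 + spatialTrace A) := by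
  have h : (a • 1 : Matrix (Fin 4) (Fin 4) ℝ) = Matrix.diagonal (Fin.cons a fun _ => a) := by
    rw [← Matrix.diagonal_one, ← Matrix.diagonal_smul]
    congr 1
    funext μ
    refine Fin.cases ?_ (fun a => ?_) μ <;> simp
  rw [h, contract_diagonal_cons]
  ring

theorem newtonianMetric_zero (c : ℝ) : newtonianMetric c 0 = eta := by
  funext x
  simp [newtonianMetric]

theorem newtonianMetric_apply (c Φ : ℝ) (x : Spacetime) :
    newtonianMetric c Φ x = Matrix.diagonal
      (Fin.cons (-1 - 2 * (Φ / c ^ 2)) fun _ => 1 - 2 * (Φ / c ^ 2)) := by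
  rw [newtonianMetric, eta, etaMatrix, ← Matrix.diagonal_one, ← Matrix.diagonal_smul,
    Matrix.diagonal_add]
  congr 1
  funext μ
  refine Fin.cases ?_ (fun a => ?_) μ <;> simp <;> ring

theorem isLorentzian_newtonianMetric {c Φ : ℝ} (h : |Φ / c ^ 2| < 1 / 2) :
    IsLorentzian (newtonianMetric c Φ) := by
  obtain ⟨h1, h2⟩ := abs_lt.1 h
  have h3 : 0 < 1 + 2 * (Φ / c ^ 2) := by linarith
  have h4 : 0 < 1 - 2 * (Φ / c ^ 2) := by linarith
  refine ⟨fun μ ν => (contDiff_const (c := (etaMatrix + (-2 * (Φ / c ^ 2)) • 1 : Matrix (Fin 4) (Fin 4) ℝ) μ ν)),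
    fun x => ⟨Matrix.diagonal
    (Fin.cons (Real.sqrt (1 + 2 * (Φ / c ^ 2)))⁻¹ fun _ => (Real.sqrt (1 - 2 * (Φ / c ^ 2)))⁻¹),
    ?_, ?_⟩⟩
  · rw [Matrix.det_diagonal, isUnit_iff_ne_zero, Finset.prod_ne_zero_iff]
    intro μ _
    refine Fin.cases ?_ (fun a => ?_) μ
    · simpa using (Real.sqrt_pos.2 h3).ne'
    · simpa using (Real.sqrt_pos.2 h4).ne'
  · rw [newtonianMetric_apply, Matrix.diagonal_transpose, Matrix.diagonal_mul_diagonal,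
      Matrix.diagonal_mul_diagonal, etaMatrix]
    congr 1
    funext μ
    have key : ∀ v : ℝ, 0 < v → (√v)⁻¹ * v * (√v)⁻¹ = 1 := fun v hv => by
      have h5 := (Real.sqrt_pos.2 hv).ne'
      nth_rewrite 2 [← Real.mul_self_sqrt hv.le]
      rw [← mul_assoc, inv_mul_cancel₀ h5, one_mul, mul_inv_cancel₀ h5]
    refine Fin.cases ?_ (fun a => ?_) μ
    · simp only [Fin.cons_zero]
      linear_combination -key _ h3
    · simp only [Fin.cons_succ]
      exact key _ h4

/-- An active rescaling removes the spatial part of the Newtonian perturbation to first order. -/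
theorem abs_pushTensor_newtonianMetric_sub_le {ξ : Space → ℝ} {y : Space} {R : ℝ}
    (hξ : ∀ z ∈ Metric.closedBall y R, ξ z = 1) {φ : ℝ → Diffeo}
    (hφ : IsFlow (rescalingField ξ y) φ) {c Φ : ℝ} (hΦ : |Φ / c ^ 2| ≤ 1 / 2) {x : Spacetime}
    (hx : spatial x ∈ Metric.ball y (R / 3)) (μ ν : Fin 4) :
    |((pushTensor (φ (Φ / c ^ 2)) (newtonianMetric c Φ) x - eta x)
      - (-2 * (Φ / c ^ 2)) • timeTime) μ ν| ≤ 12 * (Φ / c ^ 2) ^ 2 := by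
  set τ := Φ / c ^ 2 with hτ
  have h1 : φ (-τ) =ᶠ[𝓝 x] fun x => event (1 * x 0) (y + Real.exp τ • (spatial x - y)) := by
    filter_upwards [(Metric.isOpen_ball.preimage continuous_spatial).mem_nhds hx] with z hz
    rw [rescaling_flow_eq hξ hφ (Metric.ball_subset_closedBall hz)
      (by rw [abs_neg]; linarith), neg_neg, one_mul]
  have h2 : (pushTensor (φ τ) (newtonianMetric c Φ) x - eta x) - (-2 * τ) • timeTime
      = Matrix.diagonal (Fin.cons 0 fun _ => Real.exp (2 * τ) * (1 - 2 * τ) - 1) := by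
    have h3 : timeTime = Matrix.diagonal (Fin.cons 1 fun _ => 0) := by
      ext μ ν
      refine Fin.cases ?_ (fun a => ?_) μ
      · simp [timeTime, Matrix.single_apply, Matrix.diagonal_apply]
      · simp [timeTime, Matrix.diagonal_apply, (Fin.succ_ne_zero a).symm]
    rw [hφ.pushTensor_eq, jacobian_congr h1, jacobian_event_affine, newtonianMetric_apply, ← hτ,
      h3, eta, etaMatrix, Matrix.diagonal_transpose, Matrix.diagonal_mul_diagonal,
      Matrix.diagonal_mul_diagonal, ← Matrix.diagonal_smul, Matrix.diagonal_sub,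
      Matrix.diagonal_sub]
    congr 1
    funext μ
    refine Fin.cases ?_ (fun a => ?_) μ
    · simp only [Fin.cons_zero, Pi.smul_apply, smul_eq_mul]
      ring
    · simp only [Fin.cons_succ, Pi.smul_apply, smul_eq_mul]
      rw [two_mul τ, Real.exp_add]
      ring
  rw [h2]
  have h4 : |2 * τ| ≤ 1 := by rw [abs_mul, abs_two]; linarith
  have h5 := Real.abs_exp_sub_one_sub_id_le h4
  -- With `u = 2τ` and `e^u = 1 + u + ρ`, `|ρ| ≤ u²`, the quantity is `-u² + ρ (1 - u)`. As `|1 - u|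
  -- ≤ 2`, it is at most `3 u² = 12 τ²`.
  have h6 : |Real.exp (2 * τ) * (1 - 2 * τ) - 1| ≤ 12 * τ ^ 2 := by
    have h7 := abs_le.1 h4
    have h8 := abs_le.1 h5
    rw [abs_le]
    constructor <;> nlinarith
  rw [Matrix.diagonal_apply]
  split_ifs
  · refine Fin.cases ?_ (fun a => ?_) μ
    · simp only [Fin.cons_zero, abs_zero]; positivity
    · simpa using h6
  · rw [abs_zero]; positivity

end Rescaling

/-! ### The virial theorem. -/

section Virial

/-- A spatially compact field admits a complete spatial rescaling flow that is exact on
arbitrarily large balls around its support. -/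
theorem SpatiallyCompact.exists_rescaling {F : Type*} [NormedAddCommGroup F]
    {Ψ : Spacetime → F} (h : SpatiallyCompact Ψ) (y : Space) :
    ∃ (r : ℝ) (ξ : Space → ℝ) (φ : ℝ → Diffeo), (∀ x ∈ tsupport Ψ, spatial x ∈ Metric.ball y r) ∧
      ContDiff ℝ ∞ ξ ∧ HasCompactSupport ξ ∧ (∀ z ∈ Metric.closedBall y (9 * r), ξ z = 1) ∧
      IsFlow (rescalingField ξ y) φ ∧ ∀ t x, φ t x 0 = x 0 := by
  obtain ⟨K, hK, hKΨ⟩ := h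
  obtain ⟨r, hr⟩ := hK.isBounded.subset_ball y
  -- The radius `9 r` leaves room for two expansions by at most `3`: one moves the support into the
  -- ball of radius `3 r`, the other lets the inverse flow act from there as an exact rescaling.
  obtain ⟨ξ, φ, hξ, hξc, hξ1, hφ, hφ0⟩ := exists_rescaling_isFlow y (9 * r)
  exact ⟨r, ξ, φ, fun x hx => hr (hKΨ x hx), hξ, hξc, hξ1, hφ, hφ0⟩

variable {F : Type*} [NormedAddCommGroup F] [NormedSpace ℝ F] {c : ℝ} {E : NaturalBundle F}
  {S : Action F} {T : TensorField → (Spacetime → F) → TensorField} {Ψ : Spacetime → F}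

theorem ball_subset_closedBall_nine {y z : Space} {r : ℝ} (h : z ∈ Metric.ball y r) :
    Metric.closedBall y (9 * r) ∈ 𝓝 z := by
  have hr : 0 < r := dist_nonneg.trans_lt h
  exact mem_of_superset (Metric.isOpen_ball.mem_nhds h) (Metric.ball_subset_closedBall.trans
    (Metric.closedBall_subset_closedBall (by linarith)))

theorem integral_contract_lieEta_rescaling (hT : IsEnergyMomentumTensor c S T)
    (hΨ : ContDiff ℝ ∞ Ψ) {y : Space} {r : ℝ} {ξ : Space → ℝ}
    (hr : ∀ x ∈ tsupport Ψ, spatial x ∈ Metric.ball y r)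
    (hξ : ∀ z ∈ Metric.closedBall y (9 * r), ξ z = 1) (V : Set Spacetime) :
    1 / (2 * c) * ∫ x in V, contract (T eta Ψ x) (lieEta (rescalingField ξ y) x)
      = -(1 / c) * ∫ x in V, spatialTrace (T eta Ψ x) := by
  have h1 : ∀ x, contract (T eta Ψ x) (lieEta (rescalingField ξ y) x)
      = -2 * spatialTrace (T eta Ψ x) := by
    intro x
    by_cases hx : x ∈ tsupport Ψ
    · exact contract_lieEta_rescalingField
        (mem_of_superset (ball_subset_closedBall_nine (hr x hx)) hξ) _
    · rw [hT.eq_zero hΨ hx, contract_zero_left]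
      simp [spatialTrace]
  simp only [h1]
  rw [integral_const_mul]
  ring

theorem IsEnergyMomentumTensor.continuous_spatialTrace (hT : IsEnergyMomentumTensor c S T)
    (hΨ : ContDiff ℝ ∞ Ψ) : Continuous fun x => spatialTrace (T eta Ψ x) :=
  continuous_finsetSum _ fun a _ => (hT.contDiff hΨ a.succ a.succ).continuous

theorem IsEnergyMomentumTensor.integrableOn_spatialTrace (hT : IsEnergyMomentumTensor c S T)
    (hΨ : ContDiff ℝ ∞ Ψ) (hc : SpatiallyCompact Ψ) (s₀ s₁ : ℝ) :
    IntegrableOn (fun x => spatialTrace (T eta Ψ x)) {x : Spacetime | s₀ ≤ x 0 ∧ x 0 ≤ s₁} :=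
  integrableOn_of_eq_zero_off_compact (hT.continuous_spatialTrace hΨ) (hc.isCompact_inter s₀ s₁)
    (isClosed_closedSlab _ _).measurableSet fun x hx hxZ => by
      rw [hT.eq_zero hΨ fun h => hxZ ⟨h, hx⟩]
      simp [spatialTrace]

/-- Jets then form a finite-dimensional space, where closed balls are compact; a continuous density
is thus bounded on bounded jets over a compact set. -/
instance finiteDimensional_continuousMultilinearMap [FiniteDimensional ℝ F] (k : ℕ) : FiniteDimensional ℝ
    (ContinuousMultilinearMap ℝ (fun _ : Fin k => Spacetime) F) :=
  FiniteDimensional.of_injective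
    { toFun := fun f => f.toMultilinearMap
      map_add' := fun _ _ => rfl
      map_smul' := fun _ _ => rfl : ContinuousMultilinearMap ℝ (fun _ : Fin k => Spacetime) F →ₗ[ℝ]
        MultilinearMap ℝ (fun _ : Fin k => Spacetime) F }
    ContinuousMultilinearMap.toMultilinearMap_injective

/-- Integrals of local densities over a slice are bounded in terms of bounds on the jets. -/
theorem IsLocalDensity.exists_bound [FiniteDimensional ℝ F] {k : ℕ} {b : Space → Jet F k → ℝ}
    (hb : IsLocalDensity b) {K : Set Space} (hK : IsCompact K) (C : ℝ) :
    ∃ M : ℝ, ∀ Ψ : Spacetime → F, (∀ x ∈ tsupport Ψ, spatial x ∈ K) →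
      (∀ y, ‖jet k Ψ (event 0 y)‖ ≤ C) → |sliceIntegral b Ψ| ≤ M := by
  have : ProperSpace (Jet F k) := FiniteDimensional.proper ℝ _
  obtain ⟨M, hM⟩ := (hK.prod (isCompact_closedBall (0 : Jet F k) C)).exists_bound_of_continuousOn
    hb.1.continuousOn
  refine ⟨M * volume.real K, fun Ψ hΨ hC => ?_⟩
  have h1 : sliceIntegral b Ψ = ∫ y in K, b y (jet k Ψ (event 0 y)) := by
    refine (setIntegral_eq_integral_of_forall_compl_eq_zero fun y hy => ?_).symm
    have h2 : jet k Ψ (event 0 y) = 0 := by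
      funext i
      by_contra h3
      exact hy (hΨ _ (support_iteratedFDeriv_subset (𝕜 := ℝ) (i : ℕ) h3))
    rw [h2, hb.2]
  rw [h1]
  exact norm_setIntegral_le_of_norm_le_const hK.measure_lt_top fun y hy =>
    hM (y, jet k Ψ (event 0 y)) ⟨hy, by simpa using hC y⟩

theorem spatial_timeShift (s : ℝ) (x : Spacetime) :
    spatial (timeShift s x) = spatial x := by
  funext a
  show x a.succ + event s 0 a.succ = x a.succ
  simp

theorem BoundedMotion.exists_jet_bound (h : BoundedMotion E Ψ) (k : ℕ) :
    ∃ C : ℝ, ∀ s : ℝ, 0 ≤ s → ∀ y : Space,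
      ‖jet k (E.push (timeShift (-s)) Ψ) (event 0 y)‖ ≤ C := by
  choose C hC using h
  refine ⟨∑ i : Fin (k + 1), |C i|, fun s hs y => ?_⟩
  refine (pi_norm_le_iff_of_nonneg (Finset.sum_nonneg fun i _ => abs_nonneg _)).2 fun i => ?_
  calc _ ≤ C i := hC i s hs y
    _ ≤ |C i| := le_abs_self _
    _ ≤ _ := Finset.single_le_sum (f := fun i : Fin (k + 1) => |C i|) (fun i _ => abs_nonneg _)
      (Finset.mem_univ i)

/-- The virial theorem. -/
theorem tendsto_virial [FiniteDimensional ℝ F] (hc : 0 < c) (hT : IsEnergyMomentumTensor c S T)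
    (hS : DiffeoInvariant E S) (hΨ : ContDiff ℝ ∞ Ψ) (hΨs : SolvesFieldEquations S Ψ)
    (hΨc : SpatiallyCompact Ψ) (hb : BoundedMotion E Ψ) (hL : LocalTemporalBoundaryTerm c E S) :
    Tendsto (fun t : ℝ => 1 / t * ∫ x in {x : Spacetime | 0 ≤ x 0 ∧ x 0 ≤ c * t},
      spatialTrace (T eta Ψ x)) atTop (𝓝 0) := by
  obtain ⟨r, ξ, φ, hr, hξ, hξc, hξ1, hφ, hφ0⟩ := hΨc.exists_rescaling 0
  obtain ⟨k, b₁, b₀, hb₁, -, hB⟩ := hL ξ 0 φ hξ hξc hφ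
  obtain ⟨K, hK, hKΨ⟩ := id hΨc
  obtain ⟨C, hC⟩ := hb.exists_jet_bound k
  obtain ⟨M, hM⟩ := hb₁.exists_bound hK C
  -- The first variation under the rescaling is both `-(1/c) ∫ ∑ T^{aa}` and the sum of the two
  -- slice terms. The final one is bounded by `M`, independently of `t`, because time translation
  -- preserves the spatial support; the initial one does not involve `t`.
  have key : ∀ t : ℝ, 0 < t → ‖∫ x in {x : Spacetime | 0 ≤ x 0 ∧ x 0 ≤ c * t},
      spatialTrace (T eta Ψ x)‖ ≤ c * (M + |sliceIntegral b₀ Ψ|) := by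
    intro t ht
    have h1 := (hT.hasDerivAt_push hS hΨ (hΨc.admissible_slab 0 (c * t)) hφ
      (hφ.image_slab hφ0 _ _)).unique (hB Ψ hΨ hΨc hΨs t ht)
    rw [integral_contract_lieEta_rescaling hT hΨ hr hξ1,
      setIntegral_congr_set (slab_ae_eq_closedSlab 0 (c * t))] at h1
    have h2 := hM (E.push (timeShift (-(c * t))) Ψ) (fun x hx => by
      rw [E.tsupport_push] at hx
      obtain ⟨z, hz, rfl⟩ := hx
      rw [spatial_timeShift]
      exact hKΨ z hz) (hC _ (by positivity))
    have h3 : ∫ x in {x : Spacetime | 0 ≤ x 0 ∧ x 0 ≤ c * t}, spatialTrace (T eta Ψ x)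
        = -(c * (sliceIntegral b₁ (E.push (timeShift (-(c * t))) Ψ) + sliceIntegral b₀ Ψ)) := by
      rw [← h1]
      field_simp
    rw [h3, norm_neg, norm_mul, Real.norm_of_nonneg hc.le]
    gcongr
    exact (norm_add_le _ _).trans (add_le_add h2 le_rfl)
  have h0 : Tendsto (fun t : ℝ => 1 / t * (c * (M + |sliceIntegral b₀ Ψ|))) atTop (𝓝 0) := by
    have := (tendsto_inv_atTop_zero (𝕜 := ℝ)).mul_const (c * (M + |sliceIntegral b₀ Ψ|))
    simpa using this
  refine squeeze_zero_norm' ?_ h0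
  filter_upwards [eventually_gt_atTop 0] with t ht
  rw [norm_mul, Real.norm_of_nonneg (by positivity : 0 ≤ 1 / t)]
  exact mul_le_mul_of_nonneg_left (key t ht) (by positivity)

end Virial

/-! ### The anomalous coupling to the Newtonian potential. -/

section AnomalousCoupling

variable {F : Type*} [NormedAddCommGroup F] [NormedSpace ℝ F] {c : ℝ} {E : NaturalBundle F}
  {S : Action F} {T : TensorField → (Spacetime → F) → TensorField} {Ψ : Spacetime → F}

/-- The energy-momentum of a pushed-forward field varies at first order in the flow parameter. -/
theorem IsEnergyMomentumTensor.isBigO_integral_push (hT : IsEnergyMomentumTensor c S T)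
    (hΨ : ContDiff ℝ ∞ Ψ) (hΨc : SpatiallyCompact Ψ) {X : Spacetime → Spacetime}
    {φ : ℝ → Diffeo} (hφ : IsFlow X φ) (hφ0 : ∀ t x, φ t x 0 = x 0) (s₀ s₁ : ℝ) (μ ν : Fin 4) :
    (fun τ => (∫ x in slab s₀ s₁, T eta (E.push (φ τ) Ψ) x μ ν)
      - ∫ x in slab s₀ s₁, T eta Ψ x μ ν) =O[𝓝 0] fun τ : ℝ => τ := by
  have hV := isOpen_slab s₀ s₁
  have hfam := hT.contDiff_family (E.smooth_flow X φ hφ Ψ hΨ) μ ν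
  -- Since the flow preserves time slices, this compact set contains, within the slab, the supports
  -- of all pushed fields with `|τ| ≤ 1`.
  let Z : Set Spacetime := (fun p : ℝ × Spacetime => φ p.1 p.2) ''
    (Icc (-1 : ℝ) 1 ×ˢ (tsupport Ψ ∩ {x : Spacetime | s₀ ≤ x 0 ∧ x 0 ≤ s₁}))
  have hZ : IsCompact Z :=
    (isCompact_Icc.prod (hΨc.isCompact_inter s₀ s₁)).image hφ.smooth.continuous
  have hz : ∀ τ ∈ Icc (-1 : ℝ) 1, ∀ x ∈ slab s₀ s₁, x ∉ Z →
      T eta (E.push (φ τ) Ψ) x μ ν = 0 := by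
    intro τ hτ x hx hxZ
    rw [hT.eq_zero (E.contDiff_push_flow hφ hΨ τ), Matrix.zero_apply]
    rw [E.tsupport_push]
    rintro ⟨z, hz, rfl⟩
    have hx' : s₀ < z 0 ∧ z 0 < s₁ := by simpa [slab, hφ0] using hx
    exact hxZ ⟨(τ, z), ⟨hτ, hz, hx'.1.le, hx'.2.le⟩, rfl⟩
  have hz0 : ∀ x ∈ slab s₀ s₁, x ∉ Z → T eta Ψ x μ ν = 0 := by
    have := hz 0 (by simp)
    rwa [E.push_flow_zero hφ] at this
  obtain ⟨K, hK, e⟩ := exists_contDiff_eq_smul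
    (G := fun p : ℝ × Spacetime => T eta (E.push (φ p.1) Ψ) p.2 μ ν - T eta Ψ p.2 μ ν)
    (hfam.sub ((hT.contDiff hΨ μ ν).comp contDiff_snd))
    (fun x => by simp [E.push_flow_zero hφ])
  have hI : ∀ᶠ τ in 𝓝 (0 : ℝ), τ ∈ Icc (-1 : ℝ) 1 := Icc_mem_nhds (by norm_num) one_pos
  have h1 := isBigO_setIntegral (f := fun τ x => T eta (E.push (φ τ) Ψ) x μ ν - T eta Ψ x μ ν)
    (V := slab s₀ s₁) (k := 1) hK.continuous hZ hV.measurableSet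
    (hI.mono fun τ hτ x hx hxZ => by simp [hz τ hτ x hx hxZ, hz0 x hx hxZ])
    (fun τ x => by simpa using e τ x)
  simp only [pow_one] at h1
  refine h1.congr' (hI.mono fun τ hτ => ?_) EventuallyEq.rfl
  exact integral_sub
    (integrableOn_of_eq_zero_off_compact
      (hT.contDiff (E.contDiff_push_flow hφ hΨ τ) μ ν).continuous hZ hV.measurableSet (hz τ hτ))
    (integrableOn_of_eq_zero_off_compact (hT.contDiff hΨ μ ν).continuous hZ hV.measurableSet hz0)

theorem eventually_abs_div_sq_lt (c : ℝ) {a : ℝ} (ha : 0 < a) :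
    ∀ᶠ Φ in 𝓝 (0 : ℝ), |Φ / c ^ 2| < a := by
  have : Continuous fun Φ : ℝ => |Φ / c ^ 2| := by fun_prop
  exact this.continuousAt.eventually (gt_mem_nhds (by simpa using ha))

/-- The anomalous coupling to the Newtonian potential. -/
theorem isBigO_newtonian (hT : IsEnergyMomentumTensor c S T) (hΨ : ContDiff ℝ ∞ Ψ)
    {V : Set Spacetime} (hV : Admissible Ψ V) :
    (fun Φ : ℝ => S (newtonianMetric c Φ) Ψ V
      - (S eta Ψ V - 1 / c * ∫ x in V,
          Φ / c ^ 2 * (T eta Ψ x 0 0 + spatialTrace (T eta Ψ x)))) =O[𝓝 0] fun Φ : ℝ => Φ ^ 2 := by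
  have h1 := hT.isBigO_expansion hΨ hV (γ := newtonianMetric c)
    (fun μ ν => contDiff_const.add
      (((contDiff_const.mul (contDiff_fst.div_const (c ^ 2)))).mul contDiff_const))
    ((eventually_abs_div_sq_lt c one_half_pos).mono fun Φ hΦ => isLorentzian_newtonianMetric hΦ)
    (newtonianMetric_zero c) (D := fun _ => (-2 / c ^ 2) • 1) (fun x μ ν => by
      have h2 := ((((hasDerivAt_id (0 : ℝ)).div_const (c ^ 2)).const_mul (-2)).mul_const
        ((1 : Matrix (Fin 4) (Fin 4) ℝ) μ ν)).const_add (etaMatrix μ ν)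
      refine h2.congr_deriv ?_
      simp only [Matrix.smul_apply, smul_eq_mul]
      ring)
  refine h1.congr_left fun Φ => ?_
  simp only [contract_smul_one]
  rw [integral_const_mul, integral_const_mul]
  ring

/-- Absence of the anomalous coupling for the rescaled representative. -/
theorem isBigO_newtonian_push (hT : IsEnergyMomentumTensor c S T)
    (hS : DiffeoInvariant E S) (hΨ : ContDiff ℝ ∞ Ψ) (hΨc : SpatiallyCompact Ψ) {y : Space}
    {r : ℝ} {ξ : Space → ℝ} {φ : ℝ → Diffeo}
    (hr : ∀ x ∈ tsupport Ψ, spatial x ∈ Metric.ball y r)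
    (hξ : ∀ z ∈ Metric.closedBall y (9 * r), ξ z = 1) (hφ : IsFlow (rescalingField ξ y) φ)
    (hφ0 : ∀ t x, φ t x 0 = x 0) (s₀ s₁ : ℝ) :
    (fun Φ : ℝ => S (newtonianMetric c Φ) Ψ (slab s₀ s₁)
      - (S eta (E.push (φ (Φ / c ^ 2)) Ψ) (slab s₀ s₁) - 1 / c * ∫ x in slab s₀ s₁,
          Φ / c ^ 2 * T eta (E.push (φ (Φ / c ^ 2)) Ψ) x 0 0)) =O[𝓝 0] fun Φ : ℝ => Φ ^ 2 := by
  have hV := hΨc.admissible_slab s₀ s₁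
  have hτ : Tendsto (fun Φ : ℝ => Φ / c ^ 2) (𝓝 0) (𝓝 0) := by
    have : Continuous fun Φ : ℝ => Φ / c ^ 2 := by fun_prop
    simpa using this.tendsto 0
  have hO : (fun Φ : ℝ => Φ / c ^ 2) =O[𝓝 0] fun Φ : ℝ => Φ := by
    simpa [div_eq_inv_mul] using (isBigO_refl (fun Φ : ℝ => Φ) (𝓝 0)).const_mul_left (c ^ 2)⁻¹
  have h1 := isBigO_newtonian hT hΨ hV
  have h2 := ((hT.isBigO_push hS hΨ hV hφ (hφ.image_slab hφ0 s₀ s₁)).comp_tendsto hτ).trans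
    (hO.pow 2)
  have h3 := ((hT.isBigO_integral_push (E := E) hΨ hΨc hφ hφ0 s₀ s₁ 0 0).comp_tendsto hτ).trans hO
  have h4 := (hO.mul h3).const_mul_left (1 / c)
  simp only [← pow_two] at h4
  -- `h2` trades the trace term for the change of the background action, and `h4` exchanges
  -- `T^{00}[Ψ]` for `T^{00}[φ_*Ψ]` under the factor `Φ / c²`.
  refine ((h1.sub h2).add h4).congr_left fun Φ => ?_
  have hi : IntegrableOn (fun x => T eta Ψ x 0 0) (slab s₀ s₁) :=
    integrableOn_of_eq_zero_off_compact (hT.contDiff hΨ 0 0).continuous hV.2 hV.1.measurableSet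
      fun x hx hxZ => by rw [hT.eq_zero_off hΨ hx hxZ]; rfl
  have hi' : IntegrableOn (fun x => spatialTrace (T eta Ψ x)) (slab s₀ s₁) :=
    (hT.integrableOn_spatialTrace hΨ hΨc s₀ s₁).mono_set fun x hx => ⟨hx.1.le, hx.2.le⟩
  simp only [Function.comp_def]
  rw [integral_contract_lieEta_rescaling hT hΨ hr hξ, integral_const_mul, integral_const_mul,
    integral_add hi hi']
  ring

end AnomalousCoupling

end WeakGravity

/-! ### The main theorem. -/

open WeakGravity in
theorem mainTheorem1 {F : Type*} [NormedAddCommGroup F] [NormedSpace ℝ F] [FiniteDimensional ℝ F]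
    (c : ℝ) (hc : 0 < c) (E : NaturalBundle F) (S : Action F)
    (T : TensorField → (Spacetime → F) → TensorField)
    (hS : DiffeoInvariant E S) (hT : IsEnergyMomentumTensor c S T)
    (Ψ : Spacetime → F) (hΨ : ContDiff ℝ ∞ Ψ) :
    -- removal of the anomalous coupling by an active spatial rescaling
    (SpatiallyCompact Ψ → ∀ (y : Space) (s₀ s₁ : ℝ),
      ∃ (ξ : Space → ℝ) (φ : ℝ → Diffeo),
        ContDiff ℝ ∞ ξ ∧ HasCompactSupport ξ ∧ (∀ x ∈ tsupport Ψ, ξ (spatial x) = 1) ∧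
        IsFlow (rescalingField ξ y) φ ∧
        (∀ s x, φ s x 0 = x 0) ∧
        (∃ C : ℝ, ∀ᶠ Φ in 𝓝 (0 : ℝ), ∀ x ∈ tsupport (E.push (φ (Φ / c ^ 2)) Ψ), ∀ μ ν,
          |((pushTensor (φ (Φ / c ^ 2)) (newtonianMetric c Φ) x - eta x)
            - (-2 * (Φ / c ^ 2)) • timeTime) μ ν| ≤ C * Φ ^ 2) ∧
        (∀ᶠ Φ in 𝓝 (0 : ℝ),
          S (newtonianMetric c Φ) Ψ (slab s₀ s₁)
            = S (pushTensor (φ (Φ / c ^ 2)) (newtonianMetric c Φ))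
                (E.push (φ (Φ / c ^ 2)) Ψ) (slab s₀ s₁)) ∧
        ((fun Φ : ℝ => S (newtonianMetric c Φ) Ψ (slab s₀ s₁)
            - (S eta Ψ (slab s₀ s₁) - 1 / c * ∫ x in slab s₀ s₁,
                Φ / c ^ 2 * (T eta Ψ x 0 0 + spatialTrace (T eta Ψ x))))
          =O[𝓝 0] fun Φ : ℝ => Φ ^ 2) ∧
        ((fun Φ : ℝ => S (newtonianMetric c Φ) Ψ (slab s₀ s₁)
            - (S eta (E.push (φ (Φ / c ^ 2)) Ψ) (slab s₀ s₁) - 1 / c * ∫ x in slab s₀ s₁,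
                Φ / c ^ 2 * T eta (E.push (φ (Φ / c ^ 2)) Ψ) x 0 0))
          =O[𝓝 0] fun Φ : ℝ => Φ ^ 2)) ∧
    (SolvesFieldEquations S Ψ →
      -- equality of the linearised actions, background terms and coupling terms separately
      (∀ (V K : Set Spacetime) (X : Spacetime → Spacetime) (φ : ℝ → Diffeo),
        Admissible Ψ V → IsCompact K → K ⊆ V → (∀ x ∉ K, X x = 0) → IsFlow X φ →
          ((fun ε : ℝ => S eta (E.push (φ ε) Ψ) V - S eta Ψ V) =O[𝓝 0] fun ε : ℝ => ε ^ 2) ∧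
          ∀ h : ℝ → TensorField, SmoothTensorFamily h → h 0 = 0 →
            (∀ᶠ ε in 𝓝 (0 : ℝ), IsLorentzian (eta + h ε)) →
            (fun ε : ℝ => ∫ x in V, contract (T eta Ψ x)
                (h ε x - (pushTensor (φ ε) (eta + h ε) x - eta x)))
              =O[𝓝 0] fun ε : ℝ => ε ^ 2) ∧
      -- local energy-momentum conservation
      (∀ (ν : Fin 4) (x : Spacetime),
        (∀ μ, DifferentiableAt ℝ (fun z => T eta Ψ z μ ν) x) ∧
        ∑ μ, fderiv ℝ (fun z => T eta Ψ z μ ν) x (Pi.single μ 1) = 0) ∧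
      -- the virial theorem
      (SpatiallyCompact Ψ → BoundedMotion E Ψ → LocalTemporalBoundaryTerm c E S →
        (∀ t : ℝ, IntegrableOn (fun x => spatialTrace (T eta Ψ x))
          {x : Spacetime | 0 ≤ x 0 ∧ x 0 ≤ c * t}) ∧
        Tendsto (fun t : ℝ => 1 / t * ∫ x in {x : Spacetime | 0 ≤ x 0 ∧ x 0 ≤ c * t},
          spatialTrace (T eta Ψ x)) atTop (𝓝 0))) := by
  refine ⟨fun hΨc y s₀ s₁ => ?_, fun hΨs => ⟨fun V K X φ hV hK hKV hX hφ => ?_, fun ν x => ?_,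
    fun hΨc hb hL => ⟨fun t => hT.integrableOn_spatialTrace hΨ hΨc _ _,
      tendsto_virial hc hT hS hΨ hΨs hΨc hb hL⟩⟩⟩
  · obtain ⟨r, ξ, φ, hr, hξ, hξc, hξ1, hφ, hφ0⟩ := hΨc.exists_rescaling y
    have hsmall := eventually_abs_div_sq_lt c one_half_pos
    refine ⟨ξ, φ, hξ, hξc, fun x hx => hξ1 _ (mem_of_mem_nhds
      (ball_subset_closedBall_nine (hr x hx))), hφ, hφ0, ⟨12 / (c ^ 2) ^ 2, ?_⟩, ?_,
      isBigO_newtonian hT hΨ (hΨc.admissible_slab s₀ s₁),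
      isBigO_newtonian_push hT hS hΨ hΨc hr hξ1 hφ hφ0 s₀ s₁⟩
    · filter_upwards [hsmall] with Φ hΦ x hx μ ν
      -- The support has been rescaled by `exp (-Φ/c²) ≤ 3`, from the ball of radius `r` into that
      -- of radius `3 r`, where the metric estimate is valid.
      have hx' : spatial x ∈ Metric.ball y (9 * r / 3) := by
        rw [E.tsupport_push] at hx
        obtain ⟨z, hz, rfl⟩ := hx
        have hz' := hr z hz
        rw [rescaling_flow_eq hξ1 hφ (Metric.ball_subset_closedBall
          (Metric.ball_subset_ball (by have := dist_nonneg.trans_lt hz'; linarith) hz'))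
          (by linarith), spatial_event]
        rw [Metric.mem_ball, dist_eq_norm] at hz' ⊢
        rw [add_sub_cancel_left, norm_smul, Real.norm_eq_abs, Real.abs_exp]
        have h1 : Real.exp (-(Φ / c ^ 2)) ≤ 3 :=
          (Real.exp_le_exp.2 (by linarith [(abs_lt.1 hΦ).1])).trans
            (Real.exp_one_lt_d9.le.trans (by norm_num))
        nlinarith [norm_nonneg (spatial z - y)]
      refine (abs_pushTensor_newtonianMetric_sub_le hξ1 hφ hΦ.le hx' μ ν).trans_eq ?_
      rw [div_pow]
      ring
    · filter_upwards [hsmall] with Φ hΦ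
      have := hS (φ (Φ / c ^ 2)) _ Ψ _ (isLorentzian_newtonianMetric hΦ) hΨ
        (hΨc.admissible_slab s₀ s₁)
      rw [hφ.image_slab hφ0] at this
      exact this.symm
  · have h := linearised_actions hc hT hS hΨ hΨs hV hK hKV hX hφ
    exact ⟨h.1, fun k hk hk0 _ => h.2 k hk hk0⟩
  · exact ⟨fun μ => ((hT.contDiff hΨ μ ν).differentiable (by simp)) x,
      divergence_eq_zero hc hT hS hΨ hΨs ν x⟩
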